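/- Let $c\neq 0$ be a real number and let $M_2(c)$ denote the complex projective plane $\mathbb{C}P^2$ if $c>0$ and the complex hyperbolic plane $\mathbb{C}H^2$ if $c<0$, with its complex structure $J$ and its Kähler metric $G$ of constant holomorphic sectional curvature $c$. Let $M$ be a non-empty smooth ($C^\infty$) real hypersurface immersed in $M_2(c)$, that is, a smooth manifold of real dimension $3$ (without boundary) together with a smooth immersion $f:M\to M_2(c)$. Give $M$ the metric $g$ induced from $G$, and let $R$ be the Riemannian curvature tensor of $g$, $R(X,Y)Z=\nabla_X\nabla_YZ-\nabla_Y\nabla_XZ-\nabla_{[X,Y]}Z$ with $\nabla$ the Levi-Civita connection of $g$. Let $\xi=-JN$ be the structure vector, where $N$ is a (local) unit normal vector of $M$, and let $l=R(\cdot,\xi)\xi$ be the structure Jacobi operator; it does not depend on the choice of the sign of $N$. Then $l$ does not vanish identically on $M$. In other words, there is no real hypersurface in $\mathbb{C}P^2$ or $\mathbb{C}H^2$ whose structure Jacobi operator vanishes identically. -/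

import Mathlib

open scoped Manifold ContDiff LinearAlgebra.Projectivization ComplexConjugate

noncomputable section

namespace SpaceForm

/-! ## The complex projective plane as a manifold -/

/-- The complex projective plane: the complex lines in `ℂ³`. -/
def CP2 : Type := ℙ ℂ (Fin 3 → ℂ)

/-- The line `[z]` spanned by a non-zero vector `z`. -/
def CP2.mk (z : Fin 3 → ℂ) (hz : z ≠ 0) : CP2 := Projectivization.mk ℂ z hz

/-- A vector of homogeneous coordinates of a point. -/
def CP2.rep (q : CP2) : Fin 3 → ℂ := Projectivization.rep q

/-- The quotient topology of `ℂ³ ∖ {0}`. -/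
instance : TopologicalSpace CP2 :=
  inferInstanceAs (TopologicalSpace (Quotient (projectivizationSetoid ℂ (Fin 3 → ℂ))))

lemma CP2.rep_ne_zero (q : CP2) : q.rep ≠ 0 := Projectivization.rep_nonzero q

lemma CP2.mk_rep (q : CP2) : CP2.mk q.rep q.rep_ne_zero = q := Projectivization.mk_rep q

lemma CP2.mk_eq_mk_iff {z w : Fin 3 → ℂ} (hz : z ≠ 0) (hw : w ≠ 0) :
    CP2.mk z hz = CP2.mk w hw ↔ ∃ a : ℂ, a • w = z :=
  Projectivization.mk_eq_mk_iff' ℂ z w hz hw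

lemma CP2.exists_smul_rep (z : Fin 3 → ℂ) (hz : z ≠ 0) :
    ∃ a : ℂ, a ≠ 0 ∧ (CP2.mk z hz).rep = a • z := by
  obtain ⟨a, ha⟩ := Projectivization.exists_smul_eq_mk_rep ℂ z hz
  exact ⟨a, a.ne_zero, ha.symm⟩

lemma CP2.isOpen_iff {s : Set CP2} :
    IsOpen s ↔ IsOpen {z : {z : Fin 3 → ℂ // z ≠ 0} | CP2.mk z.1 z.2 ∈ s} :=
  Iff.rfl

lemma CP2.continuous_mk :
    Continuous (fun z : {z : Fin 3 → ℂ // z ≠ 0} => CP2.mk z.1 z.2) :=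
  continuous_quot_mk

/-- `w ∈ ℂ²` as a vector of `ℂ³` with the entry `t` inserted at the place `i`. -/
def insertAt (i : Fin 3) (t : ℂ) (w : Fin 2 → ℂ) : Fin 3 → ℂ :=
  Fin.insertNth (α := fun _ => ℂ) i t w

@[simp] lemma insertAt_same (i : Fin 3) (t : ℂ) (w : Fin 2 → ℂ) : insertAt i t w i = t := by
  simp [insertAt]

@[simp] lemma insertAt_succAbove (i : Fin 3) (t : ℂ) (w : Fin 2 → ℂ) (k : Fin 2) :
    insertAt i t w (i.succAbove k) = w k := by
  simp [insertAt]

lemma insertAt_one_ne_zero (i : Fin 3) (w : Fin 2 → ℂ) : insertAt i 1 w ≠ 0 := by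
  intro h
  have := congrFun h i
  simp at this

/-- The affine coordinates `z_k / z_i` (`k ≠ i`) of a point of the projective plane. -/
def affineCoord (i : Fin 3) (q : CP2) : Fin 2 → ℂ := fun k => q.rep (i.succAbove k) / q.rep i

lemma affineCoord_mk (i : Fin 3) (z : Fin 3 → ℂ) (hz : z ≠ 0) :
    affineCoord i (CP2.mk z hz) = fun k => z (i.succAbove k) / z i := by
  obtain ⟨a, ha, h⟩ := CP2.exists_smul_rep z hz
  funext k
  simp [affineCoord, h, mul_div_mul_left _ _ ha]

lemma rep_mk_apply_ne_zero_iff (i : Fin 3) (z : Fin 3 → ℂ) (hz : z ≠ 0) :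
    (CP2.mk z hz).rep i ≠ 0 ↔ z i ≠ 0 := by
  obtain ⟨a, ha, h⟩ := CP2.exists_smul_rep z hz
  simp [h, ha]

lemma continuous_coord (i : Fin 3) :
    Continuous (fun z : {z : Fin 3 → ℂ // z ≠ 0} => z.1 i) :=
  (continuous_apply i).comp continuous_subtype_val

lemma isOpen_affine (i : Fin 3) : IsOpen {q : CP2 | q.rep i ≠ 0} := by
  rw [CP2.isOpen_iff]
  have : {z : {z : Fin 3 → ℂ // z ≠ 0} | CP2.mk z.1 z.2 ∈ {q : CP2 | q.rep i ≠ 0}}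
      = {z | z.1 i ≠ 0} := by
    ext z
    exact rep_mk_apply_ne_zero_iff i z.1 z.2
  rw [this]
  exact isOpen_ne_fun (continuous_coord i) continuous_const

/-- The affine chart of the projective plane on `{z_i ≠ 0}`. -/
def affineChart (i : Fin 3) : OpenPartialHomeomorph CP2 (Fin 2 → ℂ) where
  toFun := affineCoord i
  invFun w := CP2.mk (insertAt i 1 w) (insertAt_one_ne_zero i w)
  source := {q | q.rep i ≠ 0}
  target := Set.univ
  map_source' _ _ := Set.mem_univ _
  map_target' w _ := (rep_mk_apply_ne_zero_iff i _ (insertAt_one_ne_zero i w)).2 (by simp)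
  left_inv' q hq := by
    have hq' : q.rep i ≠ 0 := hq
    conv_rhs => rw [← q.mk_rep]
    rw [CP2.mk_eq_mk_iff]
    refine ⟨(q.rep i)⁻¹, ?_⟩
    funext j
    rcases Fin.eq_self_or_eq_succAbove i j with rfl | ⟨k, rfl⟩
    · simp [hq']
    · simp [affineCoord, div_eq_inv_mul]
  right_inv' w _ := by
    rw [affineCoord_mk]
    simp
  open_source := isOpen_affine i
  open_target := isOpen_univ
  continuousOn_toFun := by
    rw [continuousOn_open_iff (isOpen_affine i)]
    intro t ht
    rw [CP2.isOpen_iff]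
    have hc : ContinuousOn (fun z : {z : Fin 3 → ℂ // z ≠ 0} =>
        (fun k => z.1 (i.succAbove k) / z.1 i : Fin 2 → ℂ)) {z | z.1 i ≠ 0} :=
      continuousOn_pi.2 fun k => ContinuousOn.div (continuous_coord _).continuousOn
        (continuous_coord i).continuousOn (fun z hz => hz)
    have ho : IsOpen {z : {z : Fin 3 → ℂ // z ≠ 0} | z.1 i ≠ 0} :=
      isOpen_ne_fun (continuous_coord i) continuous_const
    convert hc.isOpen_inter_preimage ho ht using 1
    ext z
    refine and_congr (rep_mk_apply_ne_zero_iff i z.1 z.2) ?_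
    rw [Set.mem_preimage, Set.mem_preimage, affineCoord_mk]
  continuousOn_invFun := by
    refine Continuous.continuousOn (CP2.continuous_mk.comp
      (Continuous.subtype_mk (f := fun w => insertAt i 1 w) ?_ (insertAt_one_ne_zero i)))
    refine continuous_pi fun j => ?_
    rcases Fin.eq_self_or_eq_succAbove i j with rfl | ⟨k, rfl⟩
    · simpa using continuous_const
    · simpa using continuous_apply k

lemma CP2.exists_rep_ne_zero (q : CP2) : ∃ i : Fin 3, q.rep i ≠ 0 :=
  Function.ne_iff.1 q.rep_ne_zero

/-- The index of an affine chart around `q`. -/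
def chartIndex (q : CP2) : Fin 3 := q.exists_rep_ne_zero.choose

instance : ChartedSpace (Fin 2 → ℂ) CP2 where
  atlas := Set.range affineChart
  chartAt q := affineChart (chartIndex q)
  mem_chart_source q := q.exists_rep_ne_zero.choose_spec
  chart_mem_atlas q := ⟨chartIndex q, rfl⟩

lemma contDiffOn_transition (𝕜 : Type*) [NontriviallyNormedField 𝕜] [NormedAlgebra 𝕜 ℂ]
    (n : WithTop ℕ∞) (i j : Fin 3) :
    ContDiffOn 𝕜 n ((affineChart i).symm.trans (affineChart j))
      ((affineChart i).symm.trans (affineChart j)).source := by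
  have hins : ∀ l : Fin 3, ContDiff 𝕜 n (fun w : Fin 2 → ℂ => insertAt i 1 w l) := by
    intro l
    rcases Fin.eq_self_or_eq_succAbove i l with rfl | ⟨k, rfl⟩
    · simpa using contDiff_const
    · simpa using contDiff_apply 𝕜 ℂ k
  have heq : ∀ w : Fin 2 → ℂ, ((affineChart i).symm.trans (affineChart j)) w
      = fun k => insertAt i 1 w (j.succAbove k) * (insertAt i 1 w j)⁻¹ := by
    intro w
    change affineCoord j (CP2.mk (insertAt i 1 w) (insertAt_one_ne_zero i w)) = _
    rw [affineCoord_mk]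
    rfl
  intro w hw
  have hw' : insertAt i 1 w j ≠ 0 := by
    rw [OpenPartialHomeomorph.trans_source] at hw
    exact (rep_mk_apply_ne_zero_iff j _ (insertAt_one_ne_zero i w)).1 hw.2
  refine ContDiffAt.contDiffWithinAt ?_
  rw [show (((affineChart i).symm.trans (affineChart j)) : (Fin 2 → ℂ) → Fin 2 → ℂ)
      = fun w k => insertAt i 1 w (j.succAbove k) * (insertAt i 1 w j)⁻¹ from funext heq]
  rw [contDiffAt_pi]
  intro k
  exact (hins _).contDiffAt.mul ((hins j).contDiffAt.inv hw')

/-- The projective plane is a smooth real manifold of dimension four. -/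
instance : IsManifold 𝓘(ℝ, Fin 2 → ℂ) ∞ CP2 := by
  refine isManifold_of_contDiffOn _ _ _ ?_
  rintro _ _ ⟨i, rfl⟩ ⟨j, rfl⟩
  simpa using contDiffOn_transition ℝ ∞ i j

/-- The projective plane is a complex manifold of dimension two. -/
instance : IsManifold 𝓘(ℂ, Fin 2 → ℂ) ω CP2 := by
  refine isManifold_of_contDiffOn _ _ _ ?_
  rintro _ _ ⟨i, rfl⟩ ⟨j, rfl⟩
  simpa using contDiffOn_transition ℂ ω i j

/-! ## The complex space forms `M₂(c)`, `c ≠ 0` -/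

/-- The Hermitian form `z₀ w̄₀ + sgn(c) (z₁ w̄₁ + z₂ w̄₂)` on `ℂ³`. -/
def herm (c : ℝ) (z w : Fin 3 → ℂ) : ℂ :=
  z 0 * conj (w 0) + (Real.sign c : ℂ) * (z 1 * conj (w 1) + z 2 * conj (w 2))

/-- The points of `M₂(c)`: the lines on which `herm c` is positive. For `c > 0` these are all
lines, so this is `ℂP²`; for `c < 0` these are the lines `[1 : w₁ : w₂]` with
`|w₁|² + |w₂|² < 1`, so this is `ℂH²`. It is an open subset of the projective plane. -/
def spaceForm (c : ℝ) : Set CP2 := {q | 0 < (herm c q.rep q.rep).re}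

/-- Real tangent vectors of the projective plane at `q`: vectors of `ℂ²`, in the coordinates of
the affine chart with index `chartIndex q`. -/
abbrev AmbientTangent (q : CP2) : Type := TangentSpace 𝓘(ℝ, Fin 2 → ℂ) q

/-- The vector `z ∈ ℂ³` with `q = [z]` that has a `1` at the place `chartIndex q`. -/
def homCoord (q : CP2) : Fin 3 → ℂ := insertAt (chartIndex q) 1 (affineCoord (chartIndex q) q)

/-- The vector at `homCoord q` in `ℂ³` that a tangent vector of the projective plane at `q`
lifts to: the derivative of `w ↦ insertAt (chartIndex q) 1 w`. -/
def tangentLift (q : CP2) (u : AmbientTangent q) : Fin 3 → ℂ := insertAt (chartIndex q) 0 u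

/-- The Kähler metric `G` of `M₂(c)` (the Fubini-Study metric for `c > 0`, the Bergman metric for
`c < 0`), normalized to constant holomorphic sectional curvature `c`. At `[z]`, on tangent vectors
with lifts `u`, `v` to `ℂ³`, it is
`(4 / c) Re ((⟨u, v⟩ ⟨z, z⟩ - ⟨u, z⟩ ⟨z, v⟩) / ⟨z, z⟩²)`,
which does not depend on the choice of `z` and of the lifts. -/
def ambientMetric (c : ℝ) (q : CP2) (X Y : AmbientTangent q) : ℝ :=
  let z := homCoord q
  let u := tangentLift q X
  let v := tangentLift q Y
  4 / c * ((herm c u v * herm c z z - herm c u z * herm c z v) / herm c z z ^ 2).re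

/-- The complex structure: multiplication by `i` in holomorphic coordinates. -/
def ambientJ (q : CP2) (X : AmbientTangent q) : AmbientTangent q :=
  fun k => Complex.I * (show Fin 2 → ℂ from X) k

/-! ## Riemannian curvature in coordinates -/

/-- The Euclidean space on which three-dimensional manifolds are modelled. -/
abbrev E3 : Type := EuclideanSpace ℝ (Fin 3)

/-- The partial derivative `∂_i h`. -/
def pd (i : Fin 3) (h : E3 → ℝ) (y : E3) : ℝ := fderiv ℝ h y (EuclideanSpace.single i 1)

/-- The Christoffel symbols
`Γ^k_{ij} = ½ ∑_l g^{kl} (∂_i g_{jl} + ∂_j g_{il} - ∂_l g_{ij})`. -/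
def christoffel (g : E3 → Matrix (Fin 3) (Fin 3) ℝ) (k i j : Fin 3) (y : E3) : ℝ :=
  1 / 2 * ∑ l, (g y)⁻¹ k l *
    (pd i (fun x => g x j l) y + pd j (fun x => g x i l) y - pd l (fun x => g x i j) y)

/-- The coefficients of `R(∂_i, ∂_j) ∂_m = ∑_k R^k_{ijm} ∂_k`, with the convention
`R(X, Y) Z = ∇_X ∇_Y Z - ∇_Y ∇_X Z - ∇_{[X, Y]} Z`. -/
def riemannCoeff (g : E3 → Matrix (Fin 3) (Fin 3) ℝ) (k i j m : Fin 3) (y : E3) : ℝ :=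
  pd i (christoffel g k j m) y - pd j (christoffel g k i m) y +
    ∑ s, (christoffel g k i s y * christoffel g s j m y -
      christoffel g k j s y * christoffel g s i m y)

/-- `R(X, Y) Z` at the point `y`, for vectors given by their components. -/
def riemann (g : E3 → Matrix (Fin 3) (Fin 3) ℝ) (y X Y Z : E3) : E3 :=
  WithLp.toLp 2 fun k => ∑ i, ∑ j, ∑ m, riemannCoeff g k i j m y * X i * Y j * Z m

/-! ## Real hypersurfaces and their structure Jacobi operator -/

section Hypersurface

variable {M : Type*} [TopologicalSpace M] [ChartedSpace E3 M]

/-- `f : M → M₂(c)` is an immersed smooth real hypersurface, `M` being a three-dimensional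
manifold. -/
structure IsRealHypersurface (c : ℝ) (f : M → CP2) : Prop where
  smooth : ContMDiff 𝓘(ℝ, E3) 𝓘(ℝ, Fin 2 → ℂ) ∞ f
  mem_spaceForm : ∀ p, f p ∈ spaceForm c
  immersion : ∀ p, Function.Injective (mfderiv 𝓘(ℝ, E3) 𝓘(ℝ, Fin 2 → ℂ) f p)

/-- The differential of `f` at `p`. -/
def differential (f : M → CP2) (p : M) (X : TangentSpace 𝓘(ℝ, E3) p) : AmbientTangent (f p) :=
  mfderiv 𝓘(ℝ, E3) 𝓘(ℝ, Fin 2 → ℂ) f p X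

/-- The metric `g` that the metric `G` of `M₂(c)` induces on `M`. -/
def inducedMetric (c : ℝ) (f : M → CP2) (p : M) (X Y : TangentSpace 𝓘(ℝ, E3) p) : ℝ :=
  ambientMetric c (f p) (differential f p X) (differential f p Y)

/-- The coordinate vector field `∂_i` of the chart `e`, at the point with coordinates `y`. -/
def coordVector (e : OpenPartialHomeomorph M E3) (i : Fin 3) (y : E3) :
    TangentSpace 𝓘(ℝ, E3) (e.symm y) :=
  mfderiv 𝓘(ℝ, E3) 𝓘(ℝ, E3) e.symm y (EuclideanSpace.single i (1 : ℝ) : E3)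

/-- The components `g_{ij} = g(∂_i, ∂_j)` of the induced metric in the chart `e`. -/
def metricInChart (c : ℝ) (f : M → CP2) (e : OpenPartialHomeomorph M E3) (y : E3) :
    Matrix (Fin 3) (Fin 3) ℝ :=
  Matrix.of fun i j => inducedMetric c f (e.symm y) (coordVector e i y) (coordVector e j y)

/-- The components in the chart `e` of a tangent vector at `p`. -/
def components (e : OpenPartialHomeomorph M E3) (p : M) (X : TangentSpace 𝓘(ℝ, E3) p) : E3 :=
  mfderiv 𝓘(ℝ, E3) 𝓘(ℝ, E3) e p X

/-- The components in the chart `e` of `R(X, Y) Z`, for the Riemannian curvature tensor `R` of the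
induced metric at the point `p`. -/
def curvatureInChart (c : ℝ) (f : M → CP2) (e : OpenPartialHomeomorph M E3) (p : M)
    (X Y Z : TangentSpace 𝓘(ℝ, E3) p) : E3 :=
  riemann (metricInChart c f e) (e p) (components e p X) (components e p Y) (components e p Z)

/-- `N` is a unit normal vector of the hypersurface at `p`. -/
def IsUnitNormal (c : ℝ) (f : M → CP2) (p : M) (N : AmbientTangent (f p)) : Prop :=
  ambientMetric c (f p) N N = 1 ∧
    ∀ X : TangentSpace 𝓘(ℝ, E3) p, ambientMetric c (f p) N (differential f p X) = 0

/-- `ξ` is the structure vector `-J N` at `p`, for one of the two unit normal vectors `N`. -/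
def IsStructureVector (c : ℝ) (f : M → CP2) (p : M) (ξ : TangentSpace 𝓘(ℝ, E3) p) : Prop :=
  ∃ N : AmbientTangent (f p), IsUnitNormal c f p N ∧ differential f p ξ = -ambientJ (f p) N

/-- The structure Jacobi operator `l = R(·, ξ) ξ` vanishes identically on `M`: all its components
are zero, at every point and in every chart of the atlas. (The operator is the same for
`ξ` and `-ξ`, so that no orientation has to be chosen.) -/
def StructureJacobiVanishes (c : ℝ) (f : M → CP2) : Prop :=
  ∀ p : M, ∀ e ∈ atlas E3 M, p ∈ e.source →
    ∀ ξ : TangentSpace 𝓘(ℝ, E3) p, IsStructureVector c f p ξ →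
      ∀ X : TangentSpace 𝓘(ℝ, E3) p, curvatureInChart c f e p X ξ ξ = 0

end Hypersurface

end SpaceForm

end

noncomputable section

namespace SpaceForm

/-! ### The overdetermined system satisfied by the shape operator -/

section Core

/-! Suppose that `l = 0`, and let A be the shape operator, η = g(·, ξ), α = g(Aξ, ξ). For X
orthogonal to ξ the Gauss equation becomes α AX = η(AX) Aξ - (c/4) X. If α vanished at a point, a
map of rank at most one would equal (c/4) times the identity on a plane; so α has no zeros, and A is
determined by α and the complex function w = η(AT), where T spans the (1,0) part of the holomorphic
plane.

The Codazzi equations then express the first derivatives of α and w through α, w, connection terms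
and one further real function k = ξ(α)/α². Evaluating the commutator [ξ, T] on α and on B = |w|²
yields algebraic relations that force B k = 0 and then B = 0. But w = 0 contradicts a Codazzi
equation, because c ≠ 0. This elimination is `structure_equations_inconsistent`.

The equations come from a lift to ℂ³: a unit vector Z over the point, the lift N of the normal and a
third vector E form an orthogonal frame, and commuting derivatives of the scalar components of Z and
N give the Codazzi equations (`unitary_frame_inconsistent`). The Gauss equation is `gauss_equation`.
The structure vector has an explicit formula as a normalized kernel vector of the imaginary part of
a degenerate Hermitian Gram matrix (`kernel_of_det_eq_zero`), hence is smooth.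

All algebra takes place in the ring of smooth complex functions on an open set, which is reduced but
has zero divisors. "f = 0 wherever b ≠ 0" is written b f = 0; the present lemma differentiates such
statements, so the open set never has to be shrunk. -/

lemma mul_derivation_eq_zero {A : Type*} [CommRing A] [Algebra ℂ A] [IsReduced A]
    (D : Derivation ℂ A A) {b f : A} (h : b * f = 0) : b * D f = 0 := by
  have h1 := congrArg D h
  simp only [Derivation.leibniz, smul_eq_mul, map_zero] at h1
  -- Multiplying b D f + f D b = 0 by b D f leaves (b D f)² = 0, because b f = 0.
  refine IsReduced.eq_zero _ ⟨2, ?_⟩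
  linear_combination b * D f * h1 - D f * D b * h

lemma mul_cancel_of_mul_mul {A : Type*} [CommRing A] [IsReduced A] {b f : A}
    (h : b * (b * f) = 0) : b * f = 0 :=
  IsReduced.eq_zero _ ⟨2, by linear_combination f * h⟩

/-- Linear elimination. `wX`, `vX`, `vT`, `wS`, `vS` stand for covariant derivatives such as `X v +
ρX * v` and are treated as independent unknowns; `c1'` and `c2'` are the complex conjugates of `c1`
and `c2`. One combination removes every unknown except `vX`, whose coefficient `κ * a ^ 2` is a
unit. -/
lemma first_order_solution {A : Type*} [CommRing A] {α a w v k i κ wX vX vT wS vS αT αS : A}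
    (hα : α * a = 1) (hκ : IsUnit κ)
    (c1 : wX - αT = i * w * (α + 3 * κ * a))
    (c1' : vX - αS = -(i * v * (α + 3 * κ * a)))
    (c2 : -2 * (wX * v + w * vX) * a - (κ - 2 * w * v) * k + 2 * vT =
      -2 * i * (w * v) + i * κ * (κ - 4 * (w * v)) * a ^ 2)
    (c2' : -2 * (wX * v + w * vX) * a - (κ - 2 * w * v) * k + 2 * wS =
      2 * i * (w * v) - i * κ * (κ - 4 * (w * v)) * a ^ 2)
    (c3 : -4 * v * vX * a + 2 * v ^ 2 * k + 2 * vS = 2 * i * v ^ 2)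
    (c5 : -4 * v * vT * a + 2 * v ^ 2 * a ^ 2 * αT +
      2 * (wS * v + w * vS) * a + (κ - 2 * w * v) * a ^ 2 * αS =
      -2 * i * w * v ^ 2 * a - 3 * i * v * (κ - 2 * w * v) * a) :
    vX = v * α * (k - 4 * i) := by
  obtain ⟨u, hu⟩ := hκ.exists_left_inv
  have key : κ * (vX - v * α * (k - 4 * i)) * a ^ 2 = 0 := by
    linear_combination (norm := skip) c5 + 2 * v * a * c2 - v * a * c2' - w * a * c3 +
      2 * v ^ 2 * a ^ 2 * c1 + (κ - 2 * w * v) * a ^ 2 * c1'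
    clear c1 c1' c2 c2' c3 c5 hu
    grind
  have : vX - v * α * (k - 4 * i) = 0 := by
    linear_combination u * α ^ 2 * key - (vX - v * α * (k - 4 * i)) * hu -
      u * κ * (vX - v * α * (k - 4 * i)) * (α * a + 1) * hα
  linear_combination this

/-- `X` is the derivative along ξ, `T` the one along the (1,0) vector and `S` its conjugate. `α` and
`w` are the ξ-components of the shape operator, `τ` and `σ` its remaining components up to sign, in
the form dictated by the Gauss equation; `ρX` and `ρT` are connection terms. `c1`, `c2`, `c3`, `c5`
are the Codazzi equations. Once these are solved for first derivatives, only the commutator of `X`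
and `T` is used. -/
theorem structure_equations_inconsistent {A : Type*} [CommRing A] [Algebra ℂ A] [StarRing A]
    [Nontrivial A] (X T S : Derivation ℂ A A) (hXs : ∀ f, star (X f) = X (star f))
    (hTs : ∀ f, star (T f) = S (star f))
    (hprop : ∀ m : A, m * star m = 0 → m = 0)
    {i κ α a w v ρX ρT τ σ : A} (hv : star w = v)
    (hiD : ∀ D : Derivation ℂ A A, D i = 0) (hκD : ∀ D : Derivation ℂ A A, D κ = 0)
    (hi : i ^ 2 = -1) (his : star i = -i) (hκs : star κ = κ) (hκ : IsUnit κ)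
    (hα : α * a = 1) (hαs : star α = α) (hρX : star ρX = -ρX)
    (hpos : ∀ m : A, (α ^ 2 + 8 * (w * v)) * m = 0 → m = 0)
    (hτ : τ = (κ - 2 * (w * v)) * a) (hσ : σ = -2 * v ^ 2 * a)
    (comm : ∀ f, X (T f) - T (X f) =
      i * w * X f + (ρX + i * τ) * T f + 2 * i * w ^ 2 * a * S f)
    (c1 : X w - ρX * w - T α = i * w * (α + 3 * κ * a))
    (c2 : X τ + 2 * (T (v) + ρT * v) =
      -2 * i * (w * v) + i * κ * (κ - 4 * (w * v)) * a ^ 2)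
    (c3 : X σ + 2 * ρX * σ + 2 * (S (v) - star ρT * v) = 2 * i * v ^ 2)
    (c5 : T σ + 2 * ρT * σ - S τ = i * w * σ - 3 * i * v * τ) : False := by
  have : IsReduced A := by
    rw [isReduced_iff_pow_one_lt 2 one_lt_two]
    intro m hm
    apply hprop
    apply hprop
    rw [star_mul, star_star]
    linear_combination star m ^ 2 * hm
  have hSs : ∀ f, star (S f) = T (star f) := fun f => by
    rw [← star_star (T (star f)), hTs, star_star]
  obtain ⟨h, hh⟩ : ∃ h : A, 2 * h = 1 :=
    ⟨algebraMap ℂ A (1 / 2), by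
      rw [← map_ofNat (algebraMap ℂ A) 2, ← map_mul]; norm_num⟩
  have has : star a = a := by
    have h1 := congrArg star hα
    rw [star_mul, hαs, star_one] at h1
    linear_combination a * h1 - star a * hα
  have hDa : ∀ D : Derivation ℂ A A, D a = -a ^ 2 * D α := fun D => by
    have h1 := congrArg D hα
    simp only [Derivation.leibniz, smul_eq_mul, Derivation.map_one_eq_zero] at h1
    linear_combination a * h1 - D a * hα
  have hvs : star v = w := by rw [← hv, star_star]
  -- The one first-order quantity that the Codazzi equations leave free; it is real since `X` and
  -- `α` are.
  obtain ⟨k, hk⟩ : ∃ k, k = a ^ 2 * X α := ⟨_, rfl⟩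
  have hks : star k = k := by
    rw [hk, star_mul, star_pow, has, hXs, hαs, mul_comm]
  have hXα : X α = α ^ 2 * k := by
    linear_combination (-α ^ 2) * hk - X α * (α * a + 1) * hα
  have hn2 : ∀ D : Derivation ℂ A A, D 2 = 0 := fun D => by
    simpa using D.map_natCast 2
  have simpDτ : ∀ D : Derivation ℂ A A, D τ =
      -2 * (D w * v + w * D v) * a - (κ - 2 * w * v) * a ^ 2 * D α := fun D => by
    rw [hτ]
    simp only [Derivation.leibniz, smul_eq_mul, map_sub, hκD, hDa, hn2]
    ring
  have simpDσ : ∀ D : Derivation ℂ A A, D σ = -4 * v * D v * a + 2 * v ^ 2 * a ^ 2 * D α :=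
    fun D => by
    rw [hσ]
    simp only [Derivation.leibniz, Derivation.leibniz_pow, smul_eq_mul, map_neg, hDa, hn2,
      nsmul_eq_mul]
    push_cast
    ring
  have c1' := congrArg star c1
  have c2' := congrArg star c2
  have c3' := congrArg star c3
  rw [simpDτ] at c2 c2'
  rw [simpDσ] at c3 c3' c5
  rw [simpDτ] at c5
  simp only [star_sub, star_add, star_mul, star_pow, star_neg, star_ofNat, hXs, hTs, hSs, hαs, hvs,
    hv, his, hκs, has, hρX] at c1' c2' c3'
  have hvX : X v + ρX * v = v * α * (k - 4 * i) := by
    refine first_order_solution (a := a) (vT := T v + ρT * v) (wS := S w + star ρT * w)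
      (vS := S v - star ρT * v) (wX := X w - ρX * w) (αT := T α) (αS := S α) hα hκ c1
      ?_ ?_ ?_ ?_ ?_
    · linear_combination c1'
    · linear_combination c2 - (κ - 2 * w * v) * hk
    · linear_combination c2' - (κ - 2 * w * v) * hk
    · rw [hσ] at c3
      linear_combination c3 + 2 * v ^ 2 * hk
    · rw [hσ, hτ] at c5
      linear_combination c5
  have hXv : X v = -ρX * v + v * α * (k - 4 * i) := by linear_combination hvX
  have hXw : X w = ρX * w + w * α * (k + 4 * i) := by
    have := congrArg star hXv
    simp only [hXs, hvs, star_add, star_mul, star_sub, star_neg, star_ofNat, hαs, hks, his, hρX]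
      at this
    linear_combination this
  have hTα : T α = w * (α * k + 3 * i * (α - κ * a)) := by linear_combination hXw - c1
  have hSα : S α = v * (α * k - 3 * i * (α - κ * a)) := by
    have := congrArg star hTα
    simp only [hTs, hv, star_add, star_mul, star_sub, star_ofNat, hαs, hks, his, hκs, has]
      at this
    linear_combination this
  obtain ⟨B, hB⟩ : ∃ B, B = w * v := ⟨_, rfl⟩
  have hBs : star B = B := by rw [hB, star_mul, hv, hvs]
  have hXB : X B = 2 * α * k * B := by
    rw [hB]
    simp only [Derivation.leibniz, smul_eq_mul, hXw, hXv]
    ring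
  have hTv : T v = -ρT * v + (B + κ * h) * k - i * B + i * κ * (κ - 4 * B) * a ^ 2 * h := by
    rw [hB]
    rw [hXw, hXv, hXα] at c2
    linear_combination (norm := skip) h * c2
    clear c1 c1' c2 c2' c3 c3' c5
    grind
  have hTw : T w = ρT * w + w ^ 2 * (k + 7 * i) := by
    rw [hXw, hXα, hσ] at c3'
    simp only [star_mul, star_neg, star_pow, star_ofNat, star_star, hvs, has] at c3'
    linear_combination (norm := skip) h * c3'
    clear c1 c1' c2 c2' c3 c3' c5
    grind
  have hTB : T B = w * ((2 * B + κ * h) * k + 6 * i * B + i * κ * (κ - 4 * B) * a ^ 2 * h) := by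
    rw [hB]
    simp only [Derivation.leibniz, smul_eq_mul, hTw, hTv]
    rw [hB]
    ring
  have D3 : ∀ D : Derivation ℂ A A, D 3 = 0 := fun D => by simpa using D.map_natCast 3
  have D4 : ∀ D : Derivation ℂ A A, D 4 = 0 := fun D => by simpa using D.map_natCast 4
  have D6 : ∀ D : Derivation ℂ A A, D 6 = 0 := fun D => by simpa using D.map_natCast 6
  have hhs : star h = h := by
    have := congrArg star hh
    rw [star_mul, star_one, star_ofNat] at this
    linear_combination h * this - star h * hh
  have hSB : S B = v * ((2 * B + κ * h) * k - 6 * i * B - i * κ * (κ - 4 * B) * a ^ 2 * h) := by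
    have := congrArg star hTB
    simp only [hTs, hBs, hv, star_add, star_mul, star_sub, star_pow, star_ofNat, hks, his, hκs, has,
      hhs] at this
    linear_combination this
  have hcα := comm α
  have hcB := comm B
  have hTv0 := hTv
  clear c1 c1' c2 c2' c3 c3' c5 hXv hTw hvX simpDτ simpDσ comm
  have hhD : ∀ D : Derivation ℂ A A, D h = 0 := fun D => by
    have := congrArg D hh
    simp only [Derivation.leibniz, smul_eq_mul, Derivation.map_one_eq_zero, hn2] at this
    linear_combination h * this - D h * hh
  -- The value read off from the commutator on `α`: after substituting all first derivatives it says
  -- `α ^ 2 * T k = w * p`.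
  obtain ⟨p, hp⟩ : ∃ p, p = α * X k + i * k * (3 * α ^ 2 + 5 * κ) - 12 * α ^ 2 + 15 * κ
    - 3 * κ ^ 2 * a ^ 2 - 12 * B + 12 * B * κ * a ^ 2 := ⟨_, rfl⟩
  have hTk : T k = a ^ 2 * w * p := by
    rw [hXα, hTα, hτ, ← hB] at hcα
    simp only [Derivation.leibniz, Derivation.leibniz_pow, smul_eq_mul, map_add, map_sub, hκD, hiD,
      hDa, hXα, hXw, hTα, hSα, nsmul_eq_mul, D3 X] at hcα
    push_cast at hcα
    have : α ^ 2 * T k = w * p := by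
      rw [hp]
      linear_combination (norm := skip) -hcα
      rw [hB]
      clear * - hα hi
      grind
    linear_combination a ^ 2 * this - T k * (α * a + 1) * hα
  -- The commutator on `B`. With `T k` eliminated by `hTk`, the only second-order term left is `X
  -- k`.
  have hP : w * (α * (k + 4 * i) *
        ((2 * B + κ * h) * k + 6 * i * B + i * κ * (κ - 4 * B) * a ^ 2 * h)
      + (4 * α * k ^ 2 * B + (2 * B + κ * h) * X k + 12 * i * α * k * B
        - i * κ * h * (8 * α * k * B * a ^ 2 + 2 * (κ - 4 * B) * a * k))
      - 2 * B * k * (α * k + 3 * i * (α - κ * a))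
      - 2 * α * k * ((2 * B + κ * h) * k + 6 * i * B + i * κ * (κ - 4 * B) * a ^ 2 * h)
      - 2 * i * α * k * B
      - i * a * ((κ - 2 * B) * ((2 * B + κ * h) * k + 6 * i * B + i * κ * (κ - 4 * B) * a ^ 2 * h)
        + 2 * B * ((2 * B + κ * h) * k - 6 * i * B - i * κ * (κ - 4 * B) * a ^ 2 * h))
      - 2 * B * a * p) = 0 := by
    rw [hXB, hTB, hτ, ← hB] at hcB
    simp only [Derivation.leibniz, Derivation.leibniz_pow, smul_eq_mul, map_add, map_sub, hκD, hiD,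
      hDa, hXα, hXw, hTα, hSB, hXB, hTB, hhD, hTk, nsmul_eq_mul, hn2, D4, D6] at hcB
    push_cast at hcB
    linear_combination (norm := skip) hcB
    rw [hB]
    clear * - hα hi hh
    grind
  -- Multiplication by `v` turns the prefactor `w` into the real `B`, so that conjugation separates
  -- real and imaginary parts.
  have hBP : B * (α * (k + 4 * i) *
        ((2 * B + κ * h) * k + 6 * i * B + i * κ * (κ - 4 * B) * a ^ 2 * h)
      + (4 * α * k ^ 2 * B + (2 * B + κ * h) * X k + 12 * i * α * k * B
        - i * κ * h * (8 * α * k * B * a ^ 2 + 2 * (κ - 4 * B) * a * k))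
      - 2 * B * k * (α * k + 3 * i * (α - κ * a))
      - 2 * α * k * ((2 * B + κ * h) * k + 6 * i * B + i * κ * (κ - 4 * B) * a ^ 2 * h)
      - 2 * i * α * k * B
      - i * a * ((κ - 2 * B) * ((2 * B + κ * h) * k + 6 * i * B + i * κ * (κ - 4 * B) * a ^ 2 * h)
        + 2 * B * ((2 * B + κ * h) * k - 6 * i * B - i * κ * (κ - 4 * B) * a ^ 2 * h))
      - 2 * B * a * p) = 0 := by
    linear_combination v * hP + (α * (k + 4 * i) *
        ((2 * B + κ * h) * k + 6 * i * B + i * κ * (κ - 4 * B) * a ^ 2 * h)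
      + (4 * α * k ^ 2 * B + (2 * B + κ * h) * X k + 12 * i * α * k * B
        - i * κ * h * (8 * α * k * B * a ^ 2 + 2 * (κ - 4 * B) * a * k))
      - 2 * B * k * (α * k + 3 * i * (α - κ * a))
      - 2 * α * k * ((2 * B + κ * h) * k + 6 * i * B + i * κ * (κ - 4 * B) * a ^ 2 * h)
      - 2 * i * α * k * B
      - i * a * ((κ - 2 * B) * ((2 * B + κ * h) * k + 6 * i * B + i * κ * (κ - 4 * B) * a ^ 2 * h)
        + 2 * B * ((2 * B + κ * h) * k - 6 * i * B - i * κ * (κ - 4 * B) * a ^ 2 * h))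
      - 2 * B * a * p) * hB
  clear hP
  have hBP' := congrArg star hBP
  rw [hp] at hBP hBP'
  simp only [star_add, star_mul, star_sub, star_pow, star_ofNat, star_zero, hBs, hαs, hks,
    his, hκs, has, hhs, hXs] at hBP'
  obtain ⟨u, hu⟩ := hκ.exists_left_inv
  -- The imaginary part; `X k` is real and cancels.
  have hkq : B * (k * (α ^ 2 - κ - 2 * B)) = 0 := by
    have : 4 * i * κ * a * (B * (k * (α ^ 2 - κ - 2 * B))) = 0 := by
      linear_combination (norm := skip) hBP - hBP'
      clear * - hα hi hh
      grind
    linear_combination (-(i * u * α * h ^ 2)) * this + (-(B * (k * (α ^ 2 - κ - 2 * B)))) *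
      (hu + u * κ * hα + u * κ * α * a * (2 * h + 1) * hh - u * κ * α * a * (4 * h ^ 2) * hi)
  -- Where `B * k` is non-zero, α² - 2B is the constant κ, yet its `X`-derivative is 2αk(α² - 2B) =
  -- 2ακk.
  have hBk : B * k = 0 := by
    have h1 := mul_derivation_eq_zero X hkq
    have hXq : X (k * (α ^ 2 - κ - 2 * B)) =
        X k * (α ^ 2 - κ - 2 * B) + 2 * α * k ^ 2 * (α ^ 2 - 2 * B) := by
      simp only [Derivation.leibniz, Derivation.leibniz_pow, smul_eq_mul, map_sub, hκD, hn2, hXα,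
        hXB, nsmul_eq_mul]
      push_cast
      ring
    rw [hXq] at h1
    have h2 : α * κ * (B * k ^ 3) = 0 := by
      linear_combination h * (k * h1 - X k * hkq - 2 * α * k ^ 2 * hkq) - α * κ * B * k ^ 3 * hh
    refine IsReduced.eq_zero _ ⟨3, ?_⟩
    linear_combination a * u * B ^ 2 * h2 - B ^ 3 * k ^ 3 * (hu + u * κ * hα)
  have hBX : B * X k = 0 := mul_derivation_eq_zero X hBk
  have hBT : B * T k = 0 := mul_derivation_eq_zero T hBk
  -- A common factor of the two relations that remain on the support of `B`, where k and its
  -- derivatives vanish: the commutator on `B` gives m(8B + κ) = 0, and `T k = 0` gives m(α² - κ) =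
  -- 0. The cofactors add up to α² + 8B, which is positive.
  obtain ⟨m, hm⟩ : ∃ m, m = 4 * α ^ 2 - κ + 4 * B := ⟨_, rfl⟩
  have hm1 : B * (m * (8 * B + κ)) = 0 := by
    rw [hm]
    linear_combination (norm := skip) (-2 * α ^ 3 * u) * (hBP
      - (α * (2 * B + κ * h) * k + α * (6 * i * B + i * κ * (κ - 4 * B) * a ^ 2 * h)
        + 4 * i * α * (2 * B + κ * h) + 4 * α * k * B + 12 * i * α * B
        - i * κ * h * (8 * α * B * a ^ 2 + 2 * (κ - 4 * B) * a)
        - 2 * B * (α * k + 3 * i * (α - κ * a))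
        - 2 * α * ((2 * B + κ * h) * k + (6 * i * B + i * κ * (κ - 4 * B) * a ^ 2 * h))
        - 2 * i * α * B - i * a * κ * (2 * B + κ * h) - 2 * B * a * i * (3 * α ^ 2 + 5 * κ)) * hBk
      - (2 * B + κ * h - 2 * B * α * a) * hBX)
    clear * - hα hi hh hu
    grind
  have hm2 : B * (m * (α ^ 2 - κ)) = 0 := by
    obtain ⟨t, ht⟩ : ∃ t : A, 3 * t = 1 :=
      ⟨algebraMap ℂ A (1 / 3), by
        rw [← map_ofNat (algebraMap ℂ A) 3, ← map_mul]; norm_num⟩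
    have hBp : B * p = 0 := by
      refine mul_cancel_of_mul_mul ?_
      linear_combination α ^ 2 * v * hBT - α ^ 2 * v * B * hTk -
        B * p * w * v * (α * a + 1) * hα + B * p * hB
    rw [hm]
    linear_combination (norm := skip) (-α ^ 2 * t) * (hBp - α * hBX -
      i * (3 * α ^ 2 + 5 * κ) * hBk) - (-α ^ 2 * t) * B * hp
    clear * - hα ht
    grind
  have hBm : B * m = 0 := by
    apply hpos
    rw [← hB]
    linear_combination hm1 + hm2
  have hBTm := mul_derivation_eq_zero T hBm
  have hTm : T m = 8 * α * T α + 4 * T B := by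
    rw [hm]
    simp only [Derivation.leibniz, Derivation.leibniz_pow, smul_eq_mul, map_add, map_sub, hκD, D4,
      nsmul_eq_mul]
    push_cast
    ring
  rw [hTm, hTα, hTB] at hBTm
  -- Modulo k = 0 and 4B = κ - 4α², the derivative `T m` reduces to -10iκw, which must vanish on the
  -- support of `B`.
  have hB0 : B = 0 := by
    have h1 : w * (20 * i * κ * B) = 0 := by
      linear_combination (norm := skip) -2 * hBTm + 2 * w * (8 * α ^ 2 + 4 * (2 * B + κ * h)) * hBk
        + w * (12 * i - 4 * i * κ * a ^ 2) * hBm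
      rw [hm]
      clear * - hα hi hh
      grind
    obtain ⟨t, ht⟩ : ∃ t : A, 20 * t = 1 :=
      ⟨algebraMap ℂ A (1 / 20), by
        rw [← map_ofNat (algebraMap ℂ A) 20, ← map_mul]; norm_num⟩
    refine IsReduced.eq_zero _ ⟨2, ?_⟩
    linear_combination (norm := skip) -i * t * u * v * h1
    rw [hB]
    clear * - hi ht hu
    grind
  have hw0 : w = 0 := hprop _ (by rw [hv, ← hB, hB0])
  have hv0 : v = 0 := by rw [← hv, hw0, star_zero]
  -- For w = 0 the equation for `T v` becomes κ(k + iκa²)/2 = 0. As k is real, its imaginary part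
  -- κ²a²/2 would vanish, although κ and a are units.
  rw [hv0, hB0, map_zero] at hTv0
  have h3 := congrArg star hTv0
  simp only [star_add, star_mul, star_sub, star_pow, star_ofNat, star_neg, star_zero, hks,
    his, hκs, has, hhs] at h3
  have : (1 : A) = 0 := by
    linear_combination (norm := skip) i * u ^ 2 * α ^ 2 * (hTv0 - h3)
    clear * - hi hα hh hu
    grind
  exact one_ne_zero this

end Core

/-! ### Orthogonal frames of ℂ³ over a ring with involution -/

section Frames

variable {A : Type*} [CommRing A] [StarRing A]

/-- The Hermitian form of signature `(1, s, s)` on `A³`. -/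
def sesq (s : A) (u v : Fin 3 → A) : A :=
  u 0 * star (v 0) + s * (u 1 * star (v 1) + u 2 * star (v 2))

lemma sesq_add_left (s : A) (u u' v : Fin 3 → A) :
    sesq s (u + u') v = sesq s u v + sesq s u' v := by simp [sesq]; ring

lemma sesq_smul_left (s a : A) (u v : Fin 3 → A) :
    sesq s (a • u) v = a * sesq s u v := by simp [sesq]; ring

lemma sesq_smul_right (s a : A) (u v : Fin 3 → A) :
    sesq s u (a • v) = star a * sesq s u v := by simp [sesq]; ring

lemma star_sesq {s : A} (hs : star s = s) (u v : Fin 3 → A) :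
    star (sesq s u v) = sesq s v u := by simp [sesq, hs]; ring

/-- `Z, N, E` is an orthogonal basis of squared lengths `1, κ, κ`. -/
structure IsUnitaryFrame (s κ : A) (Z N E : Fin 3 → A) : Prop where
  star_s : star s = s
  star_κ : star κ = κ
  unit_κ : IsUnit κ
  ZZ : sesq s Z Z = 1
  NN : sesq s N N = κ
  EE : sesq s E E = κ
  ZN : sesq s Z N = 0
  ZE : sesq s Z E = 0
  NE : sesq s N E = 0

namespace IsUnitaryFrame

variable {s κ : A} {Z N E : Fin 3 → A}

lemma NZ (h : IsUnitaryFrame s κ Z N E) : sesq s N Z = 0 := by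
  rw [← star_sesq h.star_s, h.ZN, star_zero]

lemma EZ (h : IsUnitaryFrame s κ Z N E) : sesq s E Z = 0 := by
  rw [← star_sesq h.star_s, h.ZE, star_zero]

lemma EN (h : IsUnitaryFrame s κ Z N E) : sesq s E N = 0 := by
  rw [← star_sesq h.star_s, h.NE, star_zero]

/-- Pairing with each frame vector isolates one coefficient. This is how the structure equations are
read off from identities between derivatives of the frame. -/
lemma coeff_eq_zero (h : IsUnitaryFrame s κ Z N E) {a b c : A}
    (h0 : ∀ j, a * Z j + b * N j + c * E j = 0) : a = 0 ∧ b = 0 ∧ c = 0 := by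
  have h1 : a • Z + b • N + c • E = 0 := funext h0
  have key : ∀ v, a * sesq s Z v + b * sesq s N v + c * sesq s E v = 0 := fun v => by
    rw [← sesq_smul_left, ← sesq_smul_left, ← sesq_smul_left, ← sesq_add_left, ← sesq_add_left, h1]
    simp [sesq]
  have hZ := key Z
  have hN := key N
  have hE := key E
  rw [h.ZZ, h.NZ, h.EZ] at hZ
  rw [h.ZN, h.NN, h.EN] at hN
  rw [h.ZE, h.NE, h.EE] at hE
  refine ⟨by simpa using hZ, ?_, ?_⟩
  · exact (h.unit_κ.mul_left_eq_zero).1 (by simpa using hN)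
  · exact (h.unit_κ.mul_left_eq_zero).1 (by simpa using hE)

/-- Orthogonality gives the frame matrix a right inverse; over a commutative ring this is also a
left inverse, which is the expansion. -/
lemma expand (h : IsUnitaryFrame s κ Z N E) {u : A} (hu : u * κ = 1) (v : Fin 3 → A) (j : Fin 3) :
    v j = sesq s v Z * Z j + u * sesq s v N * N j + u * sesq s v E * E j := by
  let f : Fin 3 → Fin 3 → A := ![Z, N, E]
  let c : Fin 3 → A := ![1, u, u]
  let F : Matrix (Fin 3) (Fin 3) A := Matrix.of f
  let G : Matrix (Fin 3) (Fin 3) A :=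
    Matrix.of fun j k => c k * ((![1, s, s] : Fin 3 → A) j * star (f k j))
  have hFG : F * G = 1 := by
    ext i k
    have h1 : (F * G) i k = c k * sesq s (f i) (f k) := by
      simp only [F, G, Matrix.mul_apply, Fin.sum_univ_three, Matrix.of_apply, sesq,
        Matrix.cons_val]
      ring
    rw [h1]
    fin_cases i <;> fin_cases k <;>
      simp [f, c, h.ZZ, h.NN, h.EE, h.ZN, h.ZE, h.NE, h.NZ, h.EZ, h.EN, hu]
  have hGF : G * F = 1 := mul_eq_one_comm.1 hFG
  have := congrFun (Matrix.vecMul_one v) j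
  rw [← hGF, ← Matrix.vecMul_vecMul] at this
  rw [← this]
  have h2 : ∀ k, Matrix.vecMul v G k = c k * sesq s v (f k) := fun k => by
    simp only [G, Matrix.vecMul, dotProduct, Fin.sum_univ_three, Matrix.of_apply, sesq,
      Matrix.cons_val]
    ring
  rw [Matrix.vecMul, dotProduct, Fin.sum_univ_three, h2, h2, h2]
  simp [F, f, c]

end IsUnitaryFrame

lemma derivation_sesq [Algebra ℂ A] {s : A} (D D' : Derivation ℂ A A)
    (hD : ∀ f, star (D' f) = D (star f)) (hs : D s = 0) (u v : Fin 3 → A) :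
    D (sesq s u v) = sesq s (fun j => D (u j)) v + sesq s u (fun j => D' (v j)) := by
  simp only [sesq, map_add, Derivation.leibniz, smul_eq_mul, hD, hs]
  ring

end Frames

/-! ### Codazzi equations from the flatness of ℂ³ -/

section Codazzi

/-- The adapted frame along a hypersurface with vanishing structure Jacobi operator cannot exist:
the vectors `Z, N, E` with `X Z = a Z - i N`, `T Z = a' Z + E`, `T̄ Z = a'' Z`. -/
theorem unitary_frame_inconsistent {A : Type*} [CommRing A] [Algebra ℂ A] [StarRing A]
    [Nontrivial A] (X T S : Derivation ℂ A A) (hXs : ∀ f, star (X f) = X (star f))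
    (hTs : ∀ f, star (T f) = S (star f))
    (hprop : ∀ m : A, m * star m = 0 → m = 0)
    (hpos : ∀ α b m : A, star α = α → IsUnit α → (α ^ 2 + 8 * (b * star b)) * m = 0 → m = 0)
    {i s κ u : A} {Z N E : Fin 3 → A}
    (hiD : ∀ D : Derivation ℂ A A, D i = 0) (hκD : ∀ D : Derivation ℂ A A, D κ = 0)
    (hsD : ∀ D : Derivation ℂ A A, D s = 0)
    (hi : i ^ 2 = -1) (his : star i = -i) (hu : u * κ = 1)
    (hF : IsUnitaryFrame s κ Z N E)
    {aX aT aS : A} (hXZ : ∀ j, X (Z j) = aX * Z j - i * N j)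
    (hTZ : ∀ j, T (Z j) = aT * Z j + E j) (hSZ : ∀ j, S (Z j) = aS * Z j)
    {p q r P Q R : A} (hXT : ∀ f, X (T f) - T (X f) = p * X f + q * T f + r * S f)
    (hTS : ∀ f, T (S f) - S (T f) = P * X f + Q * T f + R * S f)
    {nX nT nS tX τ σ : A}
    (hnX : nX = u * sesq s (fun j => X (N j)) N) (htX : tX = u * sesq s (fun j => X (N j)) E)
    (hnT : nT = u * sesq s (fun j => T (N j)) N) (hτ : τ = u * sesq s (fun j => T (N j)) E)
    (hnS : nS = u * sesq s (fun j => S (N j)) N) (hσ : σ = u * sesq s (fun j => S (N j)) E)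
    (gauss₁ : -i * (nX - aX) * τ = κ + -i * (nT - aT) * tX)
    (gauss₂ : -i * (nX - aX) * σ = -i * (nS - aS) * tX) : False := by
  have hSs : ∀ f, star (S f) = T (star f) := fun f => by
    rw [← star_star (T (star f)), hTs, star_star]
  have hus : star u = u := by
    have h1 := congrArg star hu
    rw [star_mul, hF.star_κ, star_one] at h1
    linear_combination u * h1 - star u * hu
  have dX := derivation_sesq (s := s) X X hXs (hsD X)
  have dT := derivation_sesq (s := s) T S hSs (hsD T)
  have dS := derivation_sesq (s := s) S T hTs (hsD S)
  -- pairings of the frame with the derivative of `Z`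
  have pair : ∀ (V : Fin 3 → A) (a b c : A), sesq s V (fun j => a * Z j + b * N j + c * E j) =
      star a * sesq s V Z + star b * sesq s V N + star c * sesq s V E := fun V a b c => by
    simp [sesq]; ring
  have hXZ' : (fun j => X (Z j)) = fun j => aX * Z j + -i * N j + 0 * E j := by
    funext j; rw [hXZ]; ring
  have hTZ' : (fun j => T (Z j)) = fun j => aT * Z j + 0 * N j + 1 * E j := by
    funext j; rw [hTZ]; ring
  have hSZ' : (fun j => S (Z j)) = fun j => aS * Z j + 0 * N j + 0 * E j := by
    funext j; rw [hSZ]; ring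
  -- In each derivative of `N` and `E`, the components not introduced as new names follow from
  -- differentiating the orthogonality relations.
  have hXN : ∀ j, X (N j) = nX * N j + tX * E j - i * κ * Z j := fun j => by
    have h1 := dX N Z
    rw [hF.NZ, map_zero, hXZ', pair, hF.NZ, hF.NN, hF.NE] at h1
    simp only [star_neg, his, star_zero] at h1
    rw [hF.expand hu (fun j => X (N j)) j, hnX, htX]
    linear_combination (-Z j) * h1
  have hTN : ∀ j, T (N j) = nT * N j + τ * E j := fun j => by
    have h1 := dT N Z
    rw [hF.NZ, map_zero, hSZ', pair, hF.NZ, hF.NN, hF.NE] at h1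
    simp only [star_zero] at h1
    rw [hF.expand hu (fun j => T (N j)) j, hnT, hτ]
    linear_combination (-Z j) * h1
  have hSN : ∀ j, S (N j) = nS * N j + σ * E j := fun j => by
    have h1 := dS N Z
    rw [hF.NZ, map_zero, hTZ', pair, hF.NZ, hF.NN, hF.NE] at h1
    simp only [star_zero] at h1
    rw [hF.expand hu (fun j => S (N j)) j, hnS, hσ]
    linear_combination (-Z j) * h1
  have hXN' : (fun j => X (N j)) = fun j => -(i * κ) * Z j + nX * N j + tX * E j := by
    funext j; rw [hXN]; ring
  have hTN' : (fun j => T (N j)) = fun j => 0 * Z j + nT * N j + τ * E j := by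
    funext j; rw [hTN]; ring
  have hSN' : (fun j => S (N j)) = fun j => 0 * Z j + nS * N j + σ * E j := by
    funext j; rw [hSN]; ring
  obtain ⟨rX, hrX⟩ : ∃ a, a = u * sesq s (fun j => X (E j)) E := ⟨_, rfl⟩
  obtain ⟨rT, hrT⟩ : ∃ a, a = u * sesq s (fun j => T (E j)) E := ⟨_, rfl⟩
  obtain ⟨rS, hrS⟩ : ∃ a, a = u * sesq s (fun j => S (E j)) E := ⟨_, rfl⟩
  have hXE : ∀ j, X (E j) = rX * E j - star tX * N j := fun j => by
    have h1 := dX E Z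
    have h2 := dX E N
    rw [hF.EZ, map_zero, hXZ', pair, hF.EZ, hF.EN, hF.EE, star_zero] at h1
    rw [hF.EN, map_zero, hXN', pair, hF.EZ, hF.EN, hF.EE] at h2
    rw [hF.expand hu (fun j => X (E j)) j, hrX]
    linear_combination (-Z j) * h1 - u * N j * h2 - star tX * N j * hu
  have hTE : ∀ j, T (E j) = rT * E j - star σ * N j := fun j => by
    have h1 := dT E Z
    have h2 := dT E N
    rw [hF.EZ, map_zero, hSZ', pair, hF.EZ, hF.EN, hF.EE, star_zero] at h1
    rw [hF.EN, map_zero, hSN', pair, hF.EZ, hF.EN, hF.EE] at h2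
    rw [hF.expand hu (fun j => T (E j)) j, hrT]
    linear_combination (-Z j) * h1 - u * N j * h2 - star σ * N j * hu
  have hSE : ∀ j, S (E j) = rS * E j - star τ * N j - κ * Z j := fun j => by
    have h1 := dS E Z
    have h2 := dS E N
    rw [hF.EZ, map_zero, hTZ', pair, hF.EZ, hF.EN, hF.EE, star_zero, star_one] at h1
    rw [hF.EN, map_zero, hTN', pair, hF.EZ, hF.EN, hF.EE] at h2
    rw [hF.expand hu (fun j => S (E j)) j, hrS]
    linear_combination (-Z j) * h1 - u * N j * h2 - star τ * N j * hu
  -- reality conditions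
  have pair' : ∀ (V : Fin 3 → A) (a b c : A), sesq s (fun j => a * Z j + b * N j + c * E j) V =
      a * sesq s Z V + b * sesq s N V + c * sesq s E V := fun V a b c => by
    simp [sesq]; ring
  have haX : star aX = -aX := by
    have h1 := dX Z Z
    rw [hXZ', pair, pair', hF.ZZ, hF.ZN, hF.ZE, hF.NZ, hF.EZ, Derivation.map_one_eq_zero] at h1
    linear_combination -h1
  have haT : star aT = -aS := by
    have h1 := dS Z Z
    rw [hTZ', hSZ', pair, pair', hF.ZZ, hF.ZN, hF.ZE, hF.NZ, hF.EZ,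
      Derivation.map_one_eq_zero] at h1
    linear_combination -h1
  have hnXs : star nX = -nX := by
    have h1 := dX N N
    rw [hXN', pair, pair', hF.NN, hF.ZN, hF.NE, hF.NZ, hF.EN, hκD] at h1
    linear_combination -u * h1 - (nX + star nX) * hu
  have hnTs : star nT = -nS := by
    have h1 := dS N N
    rw [hTN', hSN', pair, pair', hF.NN, hF.ZN, hF.NE, hF.NZ, hF.EN, hκD] at h1
    linear_combination -u * h1 - (nS + star nT) * hu
  have hrXs : star rX = -rX := by
    have h1 := congrArg star hrX
    have h2 := dX E E
    rw [hF.EE, hκD] at h2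
    rw [star_mul, star_sesq hF.star_s, hus] at h1
    linear_combination h1 - u * h2 + hrX
  have hrTs : star rT = -rS := by
    have h1 := congrArg star hrT
    have h2 := dS E E
    rw [hF.EE, hκD] at h2
    rw [star_mul, star_sesq hF.star_s, hus] at h1
    linear_combination h1 - u * h2 + hrS
  have hrSs : star rS = -rT := by rw [← star_star rT, hrTs, star_neg, neg_neg]
  have haSs : star aS = -aT := by rw [← star_star aT, haT, star_neg, neg_neg]
  -- commutators
  have hXS : ∀ f, X (S f) - S (X f) = star p * X f + star q * S f + star r * T f := fun f => by
    have := congrArg star (hXT (star f))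
    simpa only [star_add, star_sub, star_mul, hXs, hTs, hSs, star_star, mul_comm] using this
  have hST : ∀ f, S (T f) - T (S f) = star P * X f + star Q * S f + star R * T f := fun f => by
    have := congrArg star (hTS (star f))
    simpa only [star_add, star_sub, star_mul, hXs, hTs, hSs, star_star, mul_comm] using this
  -- The components of the frame are scalar functions, so a commutator acts on them both through the
  -- frame equations and through its structure coefficients; comparing the two expresses that ℂ³ is
  -- flat. On `Z` this determines the structure coefficients and the curvature of the phase.
  obtain ⟨z₁, z₂, z₃⟩ := hF.coeff_eq_zero (a := X aT - T aX - (p * aX + q * aT + r * aS))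
    (b := -i * aT - star tX + i * nT + i * p) (c := rX - aX + i * τ - q) fun j => by
      have := hXT (Z j)
      rw [hXZ, hTZ] at this
      simp only [map_add, map_sub, Derivation.leibniz, smul_eq_mul, hiD, hXZ, hTZ, hSZ, hXE,
        hTN] at this
      linear_combination this
  obtain ⟨-, z₅, z₆⟩ := hF.coeff_eq_zero
    (a := X aS - S aX - (star p * aX + star q * aS + star r * aT))
    (b := -i * aS + i * nS + i * star p) (c := i * σ - star r) fun j => by
      have := hXS (Z j)
      rw [hXZ, hSZ] at this
      simp only [map_sub, Derivation.leibniz, smul_eq_mul, hiD, hXZ, hTZ, hSZ,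
        hSN] at this
      linear_combination this
  obtain ⟨-, z₈, z₉⟩ := hF.coeff_eq_zero (a := T aS - S aT + κ - (P * aX + Q * aT + R * aS))
    (b := star τ + i * P) (c := aS - rS - Q) fun j => by
      have := hTS (Z j)
      rw [hTZ, hSZ] at this
      simp only [map_add, Derivation.leibniz, smul_eq_mul, hXZ, hTZ, hSZ, hSE] at this
      linear_combination this
  obtain ⟨-, z₁₁, z₁₂⟩ := hF.coeff_eq_zero
    (a := S aT - T aS - κ - (star P * aX + star Q * aS + star R * aT))
    (b := -star τ + i * star P) (c := rS - aS - star R) fun j => by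
      have := hST (Z j)
      rw [hTZ, hSZ] at this
      simp only [map_add, Derivation.leibniz, smul_eq_mul, hXZ, hTZ, hSZ, hSE] at this
      linear_combination this
  -- The same comparison on `N` contains the Codazzi equations.
  obtain ⟨-, y₁, y₂⟩ := hF.coeff_eq_zero (a := -i * κ * nT + i * κ * aT + i * κ * p)
    (b := X nT - τ * star tX - T nX + tX * star σ - (p * nX + q * nT + r * nS))
    (c := nT * tX + X τ + τ * rX - nX * τ - T tX - tX * rT + i * κ - (p * tX + q * τ + r * σ))
    fun j => by
      have := hXT (N j)
      rw [hXN, hTN] at this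
      simp only [map_add, map_sub, Derivation.leibniz, smul_eq_mul, hiD, hκD, hTZ, hXN, hTN,
        hSN, hXE, hTE] at this
      linear_combination this
  obtain ⟨-, -, y₃⟩ := hF.coeff_eq_zero (a := -i * κ * nS + κ * tX + i * κ * aS + i * κ * star p)
    (b := X nS - σ * star tX - S nX + tX * star τ - (star p * nX + star q * nS + star r * nT))
    (c := nS * tX + X σ + σ * rX - nX * σ - S tX - tX * rS -
      (star p * tX + star q * σ + star r * τ))
    fun j => by
      have := hXS (N j)
      rw [hXN, hSN] at this
      simp only [map_add, map_sub, Derivation.leibniz, smul_eq_mul, hiD, hκD, hSZ, hXN, hTN,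
        hSN, hXE, hSE] at this
      linear_combination this
  obtain ⟨-, -, y₄⟩ := hF.coeff_eq_zero (a := κ * τ + i * κ * P)
    (b := T nS - σ * star σ - S nT + τ * star τ - (P * nX + Q * nT + R * nS))
    (c := nS * τ + T σ + σ * rT - nT * σ - S τ - τ * rS - (P * tX + Q * τ + R * σ))
    fun j => by
      have := hTS (N j)
      rw [hTN, hSN] at this
      simp only [map_add, Derivation.leibniz, smul_eq_mul, hXN, hTN,
        hSN, hTE, hSE] at this
      linear_combination this
  -- the second fundamental form
  obtain ⟨α, hαd⟩ : ∃ α, α = -i * (nX - aX) := ⟨_, rfl⟩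
  obtain ⟨w, hwd⟩ : ∃ w, w = -i * (nT - aT) := ⟨_, rfl⟩
  obtain ⟨v, hvd⟩ : ∃ v, star w = v := ⟨_, rfl⟩
  have hαs : star α = α := by
    rw [hαd, star_mul, star_neg, his, star_sub, hnXs, haX]; ring
  have enX : nX = aX + i * α := by linear_combination -i * hαd + (nX - aX) * hi
  have enT : nT = aT + i * w := by linear_combination -i * hwd + (nT - aT) * hi
  have enS : nS = aS + i * v := by
    have := congrArg star enT
    rw [star_add, star_mul, hnTs, haT, his, hvd] at this
    linear_combination -this
  have hvs : star v = w := by rw [← hvd, star_star]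
  have hps : star p = -i * v := by
    rw [enS] at z₅
    linear_combination -i * z₅ + (star p + i * v) * hi
  have hp : p = i * w := by
    have := congrArg star hps
    rw [star_star, star_mul, star_neg, his, hvs] at this
    linear_combination this
  have htXs : star tX = -2 * w := by
    rw [enT, hp] at z₂
    linear_combination -z₂ + 2 * w * hi
  have htX' : tX = -2 * v := by
    have := congrArg star htXs
    rw [star_star, star_mul, star_neg, star_ofNat, hvd] at this
    linear_combination this
  have g₁ : α * τ = κ - 2 * w * v := by
    rw [← hαd, ← hwd, htX'] at gauss₁
    linear_combination gauss₁
  have g₂ : α * σ = -2 * v ^ 2 := by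
    rw [← hαd, enS, htX'] at gauss₂
    linear_combination gauss₂ + 2 * v ^ 2 * hi
  have hq : q = (rX - aX) + i * τ := by linear_combination -z₃
  have hr : r = -i * star σ := by
    have := congrArg star z₆
    rw [star_sub, star_mul, star_star, his, star_zero] at this
    linear_combination -this
  have hτs : star τ = τ := by
    have := congrArg star z₈
    rw [star_add, star_mul, star_star, his, star_zero] at this
    linear_combination -z₁₁ - this
  have hP : P = i * τ := by
    rw [hτs] at z₈
    linear_combination -i * z₈ + P * hi
  have hQ : Q = aS - rS := by linear_combination -z₉
  have hR : R = aT - rT := by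
    have := congrArg star z₁₂
    rw [star_sub, star_sub, star_star, star_zero, hrSs, haSs] at this
    linear_combination -this
  have hσs : α * star σ = -2 * w ^ 2 := by
    have := congrArg star g₂
    rw [star_mul, star_mul, star_neg, star_ofNat, star_pow, hvs, hαs] at this
    linear_combination this
  -- The inverse of α. Square ατ + 2wv = κ and replace 4w²v² by the product of ασ and its conjugate:
  -- the left side acquires the factor α, and κ² is a unit.
  obtain ⟨a, ha⟩ : ∃ a, a = u ^ 2 * (α * τ ^ 2 + 4 * τ * w * v + α * σ * star σ) := ⟨_, rfl⟩
  have hα : α * a = 1 := by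
    rw [ha]
    linear_combination u ^ 2 * (α * τ + κ + 2 * w * v) * g₁ +
      u ^ 2 * α * star σ * g₂ - 2 * u ^ 2 * v ^ 2 * hσs + (u * κ + 1) * hu
  have hτ' : τ = (κ - 2 * (w * v)) * a := by linear_combination a * g₁ - τ * hα
  have hσ' : σ = -2 * v ^ 2 * a := by linear_combination a * g₂ - σ * hα
  have hσs' : star σ = -2 * w ^ 2 * a := by linear_combination a * hσs - star σ * hα
  have D2 : ∀ D : Derivation ℂ A A, D (-2) = 0 := fun D => by
    have := D.map_natCast 2
    rw [map_neg]
    simpa using this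
  have hnTX := congrArg X enT
  have hnXT := congrArg T enX
  rw [map_add, Derivation.leibniz, smul_eq_mul, smul_eq_mul, hiD] at hnTX hnXT
  have htT := congrArg T htX'
  have htS := congrArg S htX'
  rw [Derivation.leibniz, smul_eq_mul, smul_eq_mul, D2] at htT htS
  have hrS' : rS = -star rT := by rw [hrTs, neg_neg]
  have haS' : aS = -star aT := by rw [haT, neg_neg]
  -- The phase of the frame is not normalized; the differences `rX - aX` and `rT - aT` are unchanged
  -- when `Z`, `N`, `E` are multiplied by a common phase.
  refine structure_equations_inconsistent X T S hXs hTs hprop (a := a) (ρX := rX - aX)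
    (ρT := rT - aT) hvd hiD hκD hi his hF.star_κ (IsUnit.of_mul_eq_one u (by rw [mul_comm, hu])) hα
    hαs ?_ (fun m hm => hpos α w m hαs (IsUnit.of_mul_eq_one a hα) (by rw [hvd]; exact hm)) hτ' hσ'
    ?_ ?_ ?_ ?_ ?_
  · rw [star_sub, hrXs, haX]; ring
  · intro f
    rw [hXT, hp, hq, hr, hσs']
    ring
  -- Subtracting the phase curvature `z₁` turns derivatives of `nT` and `nX` into derivatives of `w`
  -- and `α`.
  · linear_combination (norm := skip) -i * (y₁ - hnTX + hnXT - z₁)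
    rw [htXs, htX', hp, hq, hr, hσs', enT, enX, enS, hτ']
    clear * - hi hα
    grind
  · linear_combination (norm := skip) y₂ + htT
    rw [htX', hp, hq, hr, hσs', enT, enX, hσ']
    generalize X τ = dτ
    rw [hτ']
    clear * - hi hα
    grind
  · linear_combination (norm := skip) y₃ + htS
    rw [htX', hps, hq, hr, enS, enX, hrS', haS']
    simp only [star_mul, star_neg, star_star, star_add, star_sub, hτs, his, hrXs, haX]
    generalize X σ = dσ
    rw [hσ', hτ']
    clear * - hi hα
    grind
  · linear_combination (norm := skip) y₄
    rw [htX', hP, hQ, hR, enT, enS, hrS', haS']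
    generalize T σ = dσ
    generalize S τ = dτ
    rw [hσ', hτ']
    clear * - hi hα
    grind

end Codazzi

/-! ### Constructing the structure vector, the frame and its dual -/

section Coordinates

variable {A : Type*} [CommRing A] [StarRing A]

/-- For a degenerate Hermitian `3 × 3` matrix with real part `g` and imaginary part `om`, the
vector `(om₁₂, om₂₀, om₀₁)` is in the kernel of `om` and has `g`-square `det g`. -/
lemma kernel_of_det_eq_zero {A : Type*} [CommRing A] {i h r : A} (hi : i ^ 2 = -1) (hh : 2 * h = 1)
    (H g : Matrix (Fin 3) (Fin 3) A) (hdet : H.det = 0)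
    (hg : ∀ a b, g a b = h * (H a b + H b a)) (hr : r ^ 2 * g.det = 1) (om : Fin 3 → Fin 3 → A)
    (hom : ∀ a b, om a b = -i * h * (H a b - H b a)) (x : Fin 3 → A)
    (h0 : x 0 = r * om 1 2) (h1 : x 1 = r * om 2 0) (h2 : x 2 = r * om 0 1) :
    (∀ a, ∑ b, H a b * x b = ∑ b, g a b * x b) ∧ (∀ a, ∑ b, H b a * x b = ∑ b, g a b * x b) ∧
      ∑ a, ∑ b, g a b * x a * x b = 1 := by
  have hH : ∀ a b, H a b = g a b + i * om a b := fun a b => by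
    rw [hg, hom]
    linear_combination ((H a b - H b a) * h) * hi - H a b * hh
  have hgs : ∀ a b, g a b = g b a := fun a b => by rw [hg, hg, add_comm]
  have homs : ∀ a b, om a b = -om b a := fun a b => by rw [hom, hom]; ring
  have hom0 : ∀ a, om a a = 0 := fun a => by rw [hom]; ring
  -- An antisymmetric 3 × 3 matrix acts as a cross product, up to sign with this very vector.
  have hker : ∀ a, ∑ b, om a b * x b = 0 := by
    intro a
    rw [Fin.sum_univ_three, h0, h1, h2]
    fin_cases a
    · simp [hom0, homs 2 0]; ring
    · simp [hom0, homs 1 0]; ring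
    · simp [hom0, homs 2 1, homs 2 0]; ring
  refine ⟨fun a => ?_, fun a => ?_, ?_⟩
  · simp only [hH, add_mul, Finset.sum_add_distrib]
    rw [show ∑ b, i * om a b * x b = i * ∑ b, om a b * x b by
      rw [Finset.mul_sum]; exact Finset.sum_congr rfl fun _ _ => by ring, hker]
    ring
  · simp only [hH, add_mul, Finset.sum_add_distrib]
    rw [show ∑ b, i * om b a * x b = -i * ∑ b, om a b * x b by
      rw [Finset.mul_sum]; exact Finset.sum_congr rfl fun b _ => by rw [homs b a]; ring, hker]
    simp only [hgs _ a]
    ring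
  -- With v = (om₁₂, om₂₀, om₀₁), the adjugate of `om` is v vᵀ and the terms of odd degree in `om`
  -- vanish by symmetry, so det(g + i om) = det g - g(v, v).
  · rw [Matrix.det_fin_three] at hdet hr
    simp only [hH, hom0, homs 1 0, homs 2 0, homs 2 1, hgs 1 0, hgs 2 0, hgs 2 1] at hdet hr
    simp only [Fin.sum_univ_three, h0, h1, h2, homs 2 0, hgs 1 0, hgs 2 0, hgs 2 1]
    linear_combination (norm := skip) hr - r ^ 2 * hdet
    clear * - hi
    grind

/-- A Hermitian cross product completes `Z, N` to an orthogonal basis. -/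
lemma exists_isUnitaryFrame {s κ : A} {Z N : Fin 3 → A} (hs : star s = s) (hs2 : s * s = 1)
    (hκs : star κ = κ) (hκ : IsUnit κ) (ZZ : sesq s Z Z = 1) (NN : sesq s N N = κ)
    (ZN : sesq s Z N = 0) : ∃ E, IsUnitaryFrame s κ Z N E := by
  have NZ : sesq s N Z = 0 := by rw [← star_sesq hs, ZN, star_zero]
  -- The conjugate cross product, with indices raised by diag(1, s, s). Its length is computed by
  -- Lagrange's identity, and orthogonality is a determinant with a repeated row.
  refine ⟨![star (Z 1 * N 2 - Z 2 * N 1), s * star (Z 2 * N 0 - Z 0 * N 2),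
    s * star (Z 0 * N 1 - Z 1 * N 0)], hs, hκs, hκ, ZZ, NN, ?_, ZN, ?_, ?_⟩
  · simp only [sesq] at ZZ NN ZN NZ
    simp [sesq, hs]
    generalize star (Z 0) = z0, star (Z 1) = z1, star (Z 2) = z2, star (N 0) = n0,
      star (N 1) = n1, star (N 2) = n2 at *
    linear_combination (norm := skip) NN + (N 0 * n0 + s * (N 1 * n1 + N 2 * n2)) * ZZ
      - (N 0 * z0 + s * (N 1 * z1 + N 2 * z2)) * ZN
    clear * - hs2
    grind
  · simp [sesq, hs]
    linear_combination (Z 1 * (Z 2 * N 0 - Z 0 * N 2) + Z 2 * (Z 0 * N 1 - Z 1 * N 0)) * hs2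
  · simp [sesq, hs]
    linear_combination (N 1 * (Z 2 * N 0 - Z 0 * N 2) + N 2 * (Z 0 * N 1 - Z 1 * N 0)) * hs2

/-- Three vectors in the plane orthogonal to `Z` are dependent. The functional dual to `Z` is killed
by the matrix of `V`, so the adjugate shows that det V annihilates it; evaluation on `Z`, where it
is 1, then gives det V = 0 without any division. -/
lemma det_gram_eq_zero {s u : A} {Z : Fin 3 → A} (ZZ : sesq s Z Z = 1) (V : Fin 3 → Fin 3 → A)
    (hV : ∀ i, sesq s (V i) Z = 0) :
    (Matrix.of fun i j => u * sesq s (V i) (V j) : Matrix (Fin 3) (Fin 3) A).det = 0 := by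
  have h0 : (Matrix.of V).det = 0 := by
    let x : Fin 3 → A := ![star (Z 0), s * star (Z 1), s * star (Z 2)]
    have hx : ∀ v : Fin 3 → A, ∑ j, v j * x j = sesq s v Z := fun v => by
      simp only [Fin.sum_univ_three, x, sesq, Matrix.cons_val]
      ring
    have h1 : (Matrix.of V).mulVec x = 0 := by
      funext i
      simp only [Matrix.mulVec, dotProduct, Matrix.of_apply, hx, hV]
      rfl
    have h2 : (Matrix.of V).det • x = 0 := by
      have := congrArg (Matrix.mulVec (Matrix.adjugate (Matrix.of V))) h1
      rwa [Matrix.mulVec_mulVec, Matrix.adjugate_mul, Matrix.smul_mulVec, Matrix.one_mulVec,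
        Matrix.mulVec_zero] at this
    calc (Matrix.of V).det = (Matrix.of V).det * ∑ j, Z j * x j := by rw [hx, ZZ, mul_one]
      _ = ∑ j, Z j * ((Matrix.of V).det • x) j := by
        rw [Finset.mul_sum]
        exact Finset.sum_congr rfl fun j _ => by simp only [Pi.smul_apply, smul_eq_mul]; ring
      _ = 0 := by rw [h2]; simp
  have h3 : (Matrix.of fun i j => u * sesq s (V i) (V j) : Matrix (Fin 3) (Fin 3) A) =
      Matrix.of V * Matrix.of fun k j => u * ((![1, s, s] : Fin 3 → A) k * star (V j k)) := by
    ext i j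
    simp only [Matrix.mul_apply, Matrix.of_apply, Fin.sum_univ_three, sesq, Matrix.cons_val]
    ring
  rw [h3, Matrix.det_mul, h0, zero_mul]

/-- The basis dual to a coframe `ε, ε̄, η` of the metric `(ε ε̄ + ε̄ ε) / 2 + η η`. -/
lemma dual_basis {A : Type*} [CommRing A] {h : A} (ε ε' η : Fin 3 → A)
    (g g' : Matrix (Fin 3) (Fin 3) A) (hg' : g' * g = 1)
    (hg : ∀ a b, g a b = h * (ε a * ε' b + ε' a * ε b) + η a * η b)
    (t t' x : Fin 3 → A) (ht : ∀ a, t a = h * ∑ b, g' a b * ε' b)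
    (ht' : ∀ a, t' a = h * ∑ b, g' a b * ε b) (hx : ∀ a, x a = ∑ b, g' a b * η b) :
    (∑ a, t a * ε a = 1 ∧ ∑ a, t a * ε' a = 0 ∧ ∑ a, t a * η a = 0) ∧
    (∑ a, t' a * ε a = 0 ∧ ∑ a, t' a * ε' a = 1 ∧ ∑ a, t' a * η a = 0) ∧
    (∑ a, x a * ε a = 0 ∧ ∑ a, x a * ε' a = 0 ∧ ∑ a, x a * η a = 1) ∧
    ∀ (c : Fin 3 → A) a, c a = (∑ b, c b * ε b) * t a + (∑ b, c b * ε' b) * t' a +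
      (∑ b, c b * η b) * x a := by
  let M : Matrix (Fin 3) (Fin 3) A := Matrix.of ![ε, ε', η]
  let P : Matrix (Fin 3) (Fin 3) A := Matrix.of fun a k => (![t a, t' a, x a] : Fin 3 → A) k
  -- This is `g' * g = 1` with `g` written in the coframe. Exchanging the factors gives the duality
  -- relations.
  have hPM : P * M = 1 := by
    rw [← hg']
    ext a b
    simp only [P, M, Matrix.mul_apply, Fin.sum_univ_three, Matrix.of_apply, Matrix.cons_val, ht,
      ht', hx, hg]
    ring
  have hMP : M * P = 1 := mul_eq_one_comm.1 hPM
  have key : ∀ k l, ∑ a, P a l * M k a = (1 : Matrix (Fin 3) (Fin 3) A) k l := fun k l => by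
    rw [← hMP, Matrix.mul_apply]
    exact Finset.sum_congr rfl fun _ _ => mul_comm _ _
  refine ⟨⟨key 0 0, key 1 0, key 2 0⟩, ⟨key 0 1, key 1 1, key 2 1⟩, ⟨key 0 2, key 1 2, key 2 2⟩, ?_⟩
  intro c a
  have := congrFun (Matrix.mulVec_mulVec c P M) a
  rw [hPM, Matrix.one_mulVec] at this
  rw [← this]
  simp only [P, M, Matrix.mulVec, dotProduct, Fin.sum_univ_three, Matrix.of_apply, Matrix.cons_val]
  ring

end Coordinates

/-! ### The Gauss equation -/

section Gauss

lemma sesq_sub_left {A : Type*} [CommRing A] [StarRing A] (s c : A) (u v w : Fin 3 → A) :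
    sesq s (fun j => u j - c * v j) w = sesq s u w - c * sesq s v w := by simp [sesq]; ring

lemma sesq_sub_right {A : Type*} [CommRing A] [StarRing A] (s c : A) (u v w : Fin 3 → A) :
    sesq s w (fun j => u j - c * v j) = sesq s w u - star c * sesq s w v := by simp [sesq]; ring

lemma sesq_sum_mul_left {A : Type*} [CommRing A] [StarRing A] (s : A) (c : Fin 3 → A)
    (V : Fin 3 → Fin 3 → A) (w : Fin 3 → A) :
    sesq s (fun j => ∑ k, c k * V k j) w = ∑ k, c k * sesq s (V k) w := by
  simp [sesq, Fin.sum_univ_three]; ring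

lemma sesq_sum_mul_right {A : Type*} [CommRing A] [StarRing A] (s : A) (c : Fin 3 → A)
    (V : Fin 3 → Fin 3 → A) (w : Fin 3 → A) :
    sesq s w (fun j => ∑ k, c k * V k j) = ∑ k, star (c k) * sesq s w (V k) := by
  simp [sesq, Fin.sum_univ_three]; ring

/-- The structure vector `x` is inserted into the second and third slots. The curvature term
vanishes because `l = 0`; the phase curvature `f` and one `W` term drop out by `e(x) = 0`. -/
lemma contract_gauss {A : Type*} [CommRing A] {κ : A} (f W H : Fin 3 → Fin 3 → A)
    (R : Fin 3 → Fin 3 → Fin 3 → Fin 3 → A) (x e B ν : Fin 3 → A)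
    (gauss : ∀ a b c, -f a b * e c = ∑ k, R k a b c * e k + H b c * B a - W c b * e a
      - H a c * B b + W c a * e b)
    (hR : ∀ k a, ∑ b, ∑ c, R k a b c * x b * x c = 0) (he : ∑ a, x a * e a = 0)
    (hW : ∑ b, ∑ c, x b * x c * W c b = κ) (hH : ∀ a, ∑ c, x c * H a c = ν a) (a : Fin 3) :
    (∑ b, x b * ν b) * B a - κ * e a - ν a * ∑ b, x b * B b = 0 := by
  have h1 : ∑ b, ∑ c, x b * x c * (-f a b * e c - (∑ k, R k a b c * e k + H b c * B a - W c b * e a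
      - H a c * B b + W c a * e b)) = 0 :=
    Finset.sum_eq_zero fun b _ => Finset.sum_eq_zero fun c _ => by rw [gauss]; ring
  have h2 := hR 0 a
  have h3 := hR 1 a
  have h4 := hR 2 a
  have h5 := hH 0
  have h6 := hH 1
  have h7 := hH 2
  have h8 := hH a
  simp only [Fin.sum_univ_three] at *
  linear_combination -h1 - e 0 * h2 - e 1 * h3 - e 2 * h4 +
    (-(f a 0 * x 0 + f a 1 * x 1 + f a 2 * x 2)) * he + e a * hW - B a * (x 0 * h5 + x 1 * h6 +
    x 2 * h7) + (x 0 * B 0 + x 1 * B 1 + x 2 * B 2) * h8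
      - (x 0 * W 0 a + x 1 * W 1 a + x 2 * W 2 a) * he

variable {A : Type*} [CommRing A] [Algebra ℂ A] [StarRing A]

/-- The components `R^k_{abc}` of the curvature of the connection with Christoffel symbols
`Γ^k_{ab}`, in a ring with three derivations. -/
def curvatureCoeff (δ : Fin 3 → Derivation ℂ A A) (Γ : Fin 3 → Fin 3 → Fin 3 → A)
    (k a b c : Fin 3) : A :=
  δ a (Γ k b c) - δ b (Γ k a c) + ∑ m, (Γ k a m * Γ m b c - Γ k b m * Γ m a c)

/-- Subtracting the phase term `θ` from `δ` gives a covariant derivative with curvature `f`. By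
Koszul's formula, the derivative of `V b` minus its Christoffel part is normal to the hypersurface,
apart from a multiple of `Z`. Commuting two covariant derivatives of `V c` and pairing with `E`
gives the component of the Gauss equation that is contracted at the end. -/
lemma gauss_equation {δ : Fin 3 → Derivation ℂ A A} (hδs : ∀ a f, star (δ a f) = δ a (star f))
    (hδc : ∀ a b f, δ a (δ b f) = δ b (δ a f)) {i s κ u h : A} {Z N E : Fin 3 → A}
    (hsD : ∀ D : Derivation ℂ A A, D s = 0) (hκD : ∀ D : Derivation ℂ A A, D κ = 0)
    (huD : ∀ D : Derivation ℂ A A, D u = 0) (hhD : ∀ D : Derivation ℂ A A, D h = 0)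
    (hi : i ^ 2 = -1) (his : star i = -i) (hu : u * κ = 1) (hh : 2 * h = 1)
    (hF : IsUnitaryFrame s κ Z N E) (θ : Fin 3 → A) (V : Fin 3 → Fin 3 → A)
    (hθ : ∀ a, θ a = sesq s (fun j => δ a (Z j)) Z)
    (hVdef : ∀ a, V a = fun j => δ a (Z j) - θ a * Z j) (g : Fin 3 → Fin 3 → A)
    (hg : ∀ a b, g a b = h * u * (sesq s (V a) (V b) +
      sesq s (V b) (V a)))
    (Γ : Fin 3 → Fin 3 → Fin 3 → A) (hΓs : ∀ k a b, star (Γ k a b) = Γ k a b)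
    (hΓ : ∀ l a b, ∑ k, g l k * Γ k a b = h * (δ a (g b l) + δ b (g a l) - δ l (g a b)))
    (t x : Fin 3 → A) (hxs : ∀ a, star (x a) = x a)
    (htV : ∀ j, ∑ a, t a * V a j = E j)
    (htV' : ∀ j, ∑ a, star (t a) * V a j = 0)
    (hxV : ∀ j, ∑ a, x a * V a j = -i * N j)
    (hVN : ∀ a, sesq s (V a) N + sesq s N (V a) = 0)
    (hR : ∀ k a, ∑ b, ∑ c, curvatureCoeff δ Γ k a b c * x b * x c = 0)
    (ν B e : Fin 3 → A)
    (hν : ∀ a, ν a = -i * (u * sesq s (fun j => δ a (N j)) N - θ a))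
    (hB : ∀ a, B a = sesq s (fun j => δ a (N j)) E) (he : ∀ a, e a = sesq s (V a) E)
    (a : Fin 3) :
    (∑ b, x b * ν b) * B a - κ * e a - ν a * ∑ b, x b * B b = 0 := by
  have dδ : ∀ a (u v : Fin 3 → A), δ a (sesq s u v) = sesq s (fun j => δ a (u j)) v +
      sesq s u (fun j => δ a (v j)) := fun a => derivation_sesq (δ a) (δ a) (hδs a) (hsD _)
  have hθs : ∀ a, star (θ a) = -θ a := fun a => by
    have := dδ a Z Z
    rw [hF.ZZ, Derivation.map_one_eq_zero] at this
    rw [hθ, star_sesq hF.star_s]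
    linear_combination -this
  -- the covariant derivative
  let nab : Fin 3 → (Fin 3 → A) → Fin 3 → A := fun a v j => δ a (v j) - θ a * v j
  have dnab : ∀ a (u v : Fin 3 → A), δ a (sesq s u v) = sesq s (nab a u) v +
      sesq s u (nab a v) := fun a u v => by
    simp only [nab]
    rw [dδ, sesq_sub_left, sesq_sub_right, hθs]
    ring
  have nabZ : ∀ a, nab a Z = V a := fun a => by rw [hVdef]
  have VZ : ∀ a, sesq s (V a) Z = 0 := fun a => by
    rw [hVdef, sesq_sub_left, hF.ZZ, hθ]; ring
  have ZV : ∀ a, sesq s Z (V a) = 0 := fun a => by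
    rw [← star_sesq hF.star_s, VZ, star_zero]
  let f : Fin 3 → Fin 3 → A := fun a b => δ a (θ b) - δ b (θ a)
  have nabcomm : ∀ a b (v : Fin 3 → A) j, nab a (nab b v) j = nab b (nab a v) j - f a b * v j := by
    intro a b v j
    simp only [nab, f, map_sub, Derivation.leibniz, smul_eq_mul]
    linear_combination hδc a b (v j)
  have nabV : ∀ a b, nab a (V b) = fun j => nab b (V a) j - f a b * Z j := fun a b => by
    funext j
    rw [← nabZ, ← nabZ, nabcomm]
  have hg' : ∀ a b, g a b = g b a := fun a b => by rw [hg, hg, add_comm]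
  let q : Fin 3 → Fin 3 → Fin 3 → A := fun a b c =>
    h * u * (sesq s (nab a (V b)) (V c) + sesq s (V c) (nab a (V b)))
  -- Absence of torsion: the phase curvature only adds a multiple of `Z`, which is orthogonal to
  -- every `V c`.
  have qsymm : ∀ a b c, q a b c = q b a c := fun a b c => by
    simp only [q]
    rw [nabV a b, sesq_sub_left, sesq_sub_right, ZV, VZ]
    ring
  have dg : ∀ a b c, δ a (g b c) = q a b c + q a c b := fun a b c => by
    simp only [hg, q, Derivation.leibniz, smul_eq_mul, huD, hhD, map_add, dnab]
    ring
  have koszul : ∀ l a b, ∑ k, g l k * Γ k a b = q a b l := fun l a b => by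
    rw [hΓ, dg, dg, dg, qsymm b a l, qsymm a l b, qsymm b l a]
    linear_combination q a b l * hh
  -- the part of the second derivative normal to the hypersurface
  let d : Fin 3 → Fin 3 → Fin 3 → A := fun a b j => nab a (V b) j - ∑ k, Γ k a b * V k j
  have subL : ∀ a b v, sesq s (d a b) v = sesq s (nab a (V b)) v - ∑ k, Γ k a b * sesq s (V k) v :=
    fun a b v => by
    have := sesq_sub_left s 1 (nab a (V b)) (fun j => ∑ k, Γ k a b * V k j) v
    rw [sesq_sum_mul_left] at this
    simpa only [one_mul] using this
  have subR : ∀ a b v, sesq s v (d a b) = sesq s v (nab a (V b)) - ∑ k, Γ k a b * sesq s v (V k) :=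
    fun a b v => by
    have := sesq_sub_right s 1 (nab a (V b)) (fun j => ∑ k, Γ k a b * V k j) v
    rw [sesq_sum_mul_right] at this
    simpa only [one_mul, star_one, hΓs] using this
  have dV : ∀ a b l, sesq s (d a b) (V l) + sesq s (V l) (d a b) = 0 := fun a b l => by
    have h1 := koszul l a b
    simp only [hg, q, Fin.sum_univ_three] at h1
    rw [subL, subR]
    simp only [Fin.sum_univ_three]
    linear_combination (norm := skip) -2 * κ * h1
    clear * - hu hh
    grind
  have hxV' : (fun j => ∑ a, x a * V a j) = -i • N := funext hxV
  -- `dV` controls only the real part of the pairing. The weights `star (t l)` turn one summand into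
  -- the pairing with `E` and annihilate the other.
  have dE : ∀ a b, sesq s (d a b) E = 0 := fun a b => by
    have h1 : ∑ l, star (t l) * (sesq s (d a b) (V l) + sesq s (V l) (d a b)) = 0 := by
      simp only [dV, mul_zero, Finset.sum_const_zero]
    simp only [mul_add, Finset.sum_add_distrib] at h1
    rw [← sesq_sum_mul_right, ← sesq_sum_mul_left, funext htV, funext htV'] at h1
    simpa [sesq] using h1
  -- `-i N` is tangent, so the pairing with `N` has no imaginary part.
  have dN : ∀ a b, sesq s (d a b) N = sesq s N (d a b) := fun a b => by
    have h1 : ∑ l, x l * (sesq s (d a b) (V l) + sesq s (V l) (d a b)) = 0 := by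
      simp only [dV, mul_zero, Finset.sum_const_zero]
    simp only [mul_add, Finset.sum_add_distrib] at h1
    have h2 := sesq_sum_mul_right s x V (d a b)
    have h3 := sesq_sum_mul_left s x V (d a b)
    simp only [hxs] at h2
    rw [hxV', sesq_smul_right, star_neg, his] at h2
    rw [hxV', sesq_smul_left] at h3
    linear_combination -i * (h1 + h2 + h3) + (sesq s (d a b) N - sesq s N (d a b)) * hi
  have parseval : ∀ v w : Fin 3 → A, sesq s v w = sesq s v Z * sesq s Z w +
      u * sesq s v N * sesq s N w + u * sesq s v E * sesq s E w := fun v w => by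
    have h1 : v = sesq s v Z • Z + (u * sesq s v N) • N + (u * sesq s v E) • E :=
      funext fun j => by simpa using hF.expand hu v j
    conv_lhs => rw [h1]
    rw [sesq_add_left, sesq_add_left, sesq_smul_left, sesq_smul_left, sesq_smul_left]
  have hnabE : ∀ a b, sesq s (nab a (V b)) E = ∑ k, Γ k a b * e k := fun a b => by
    have := subL a b E
    rw [dE] at this
    simp only [← he] at this
    linear_combination -this
  have hnabN : ∀ a, B a = sesq s (nab a N) E := fun a => by
    simp only [nab]
    rw [sesq_sub_left, hF.NE, hB]; ring
  have hdnab : ∀ a b c, sesq s (d b c) (nab a E) =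
      sesq s (V c) (V b) * e a - u * sesq s (d b c) N * B a := fun a b c => by
    have h1 := dnab b (V c) Z
    have h2 := dnab a Z E
    have h3 := dnab a N E
    rw [VZ, map_zero, nabZ] at h1
    rw [hF.ZE, map_zero, nabZ, ← he] at h2
    rw [hF.NE, map_zero, ← hnabN] at h3
    have h4 : sesq s (d b c) Z = sesq s (nab b (V c)) Z := by
      rw [subL]; simp only [VZ, mul_zero, Finset.sum_const_zero, sub_zero]
    rw [parseval, dE, h4]
    linear_combination (-(sesq s Z (nab a E))) * h1 + sesq s (V c) (V b) * h2 -
      u * sesq s (d b c) N * h3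
  have second : ∀ a b c, sesq s (nab a (nab b (V c))) E = ∑ k, (δ a (Γ k b c) +
      ∑ m, Γ k a m * Γ m b c) * e k - sesq s (d b c) (nab a E) := fun a b c => by
    have h1 := dnab a (nab b (V c)) E
    rw [hnabE] at h1
    have h2 : ∀ k, δ a (e k) = ∑ m, Γ m a k * e m + sesq s (V k) (nab a E) := fun k => by
      rw [he, dnab, hnabE]
    have h3 := subL b c (nab a E)
    simp only [Fin.sum_univ_three, map_add, Derivation.leibniz, smul_eq_mul, h2] at h1 h3 ⊢
    linear_combination -h1 + h3
  have gauss : ∀ a b c, -f a b * e c = ∑ k, curvatureCoeff δ Γ k a b c * e k +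
      u * sesq s (d b c) N * B a - sesq s (V c) (V b) * e a - u * sesq s (d a c) N * B b +
      sesq s (V c) (V a) * e b := fun a b c => by
    have h1 : nab a (nab b (V c)) = fun j => nab b (nab a (V c)) j - f a b * V c j :=
      funext (nabcomm a b (V c))
    have h2 : sesq s (nab a (nab b (V c))) E =
        sesq s (fun j => nab b (nab a (V c)) j - f a b * V c j) E := by rw [h1]
    rw [second, sesq_sub_left, second, hdnab, hdnab, ← he] at h2
    simp only [curvatureCoeff, Fin.sum_univ_three] at h2 ⊢
    linear_combination -h2
  -- Weingarten's formula: differentiating the normality of `N` moves the derivative from `V c` to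
  -- `N`.
  have hH : ∀ a, ∑ c, x c * (u * sesq s (d a c) N) = ν a := fun a => by
    have h1 : ∀ c, 2 * (u * sesq s (d a c) N) =
        -u * (sesq s (V c) (nab a N) + sesq s (nab a N) (V c)) := fun c => by
      have h2 := congrArg (δ a) (hVN c)
      rw [map_add, map_zero, dnab, dnab] at h2
      have h3 := subL a c N
      have h4 := subR a c N
      have h5 := dN a c
      have h6 : ∑ k, Γ k a c * (sesq s (V k) N + sesq s N (V k)) = 0 := by
        simp only [hVN, mul_zero, Finset.sum_const_zero]
      simp only [Fin.sum_univ_three] at h3 h4 h6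
      linear_combination u * h5 + u * h3 + u * h4 + u * h2 - u * h6
    have h2 : 2 * ∑ c, x c * (u * sesq s (d a c) N) = -u * (∑ c, x c * sesq s (V c) (nab a N) +
        ∑ c, x c * sesq s (nab a N) (V c)) := by
      simp only [Fin.sum_univ_three]
      linear_combination x 0 * h1 0 + x 1 * h1 1 + x 2 * h1 2
    have h3 := sesq_sum_mul_right s x V (nab a N)
    have h4 := sesq_sum_mul_left s x V (nab a N)
    simp only [hxs] at h3
    rw [← h3, ← h4, hxV', sesq_smul_left, sesq_smul_right, star_neg, his] at h2
    have h5 := dnab a N N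
    rw [hF.NN, hκD] at h5
    have h6 : sesq s (nab a N) N = sesq s (fun j => δ a (N j)) N - θ a * κ := by
      simp only [nab]
      rw [sesq_sub_left, hF.NN]
    rw [hν]
    linear_combination h * h2 - (∑ c, x c * (u * sesq s (d a c) N)) * hh - h * u * i * h5
      - i * u * sesq s (nab a N) N * hh - i * u * h6 + i * θ a * hu
  have he0 : ∑ a, x a * e a = 0 := by
    simp only [he]
    rw [← sesq_sum_mul_left, hxV', sesq_smul_left, hF.NE, mul_zero]
  have hW : ∑ b, ∑ c, x b * x c * sesq s (V c) (V b) = κ := by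
    have h1 := sesq_sum_mul_left s x V (-i • N)
    have h2 : ∀ c, sesq s (V c) (-i • N) = ∑ b, x b * sesq s (V c) (V b) := fun c => by
      rw [← hxV', sesq_sum_mul_right]
      simp only [hxs]
    rw [hxV', sesq_smul_left, sesq_smul_right, hF.NN, star_neg, his] at h1
    simp only [h2] at h1
    rw [Finset.sum_comm]
    simp only [Fin.sum_univ_three] at h1 ⊢
    linear_combination -h1 - κ * hi
  exact contract_gauss f (fun c b => sesq s (V c) (V b)) (fun b c => u * sesq s (d b c) N) _ x e B ν
    gauss hR he0 hW hH a

end Gauss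

/-! ### The adapted frame in coordinates -/

section Hypersurface

variable {A : Type*} [CommRing A] [Algebra ℂ A]

/-- The derivation `∑ c_a δ_a`. -/
def combDer (δ : Fin 3 → Derivation ℂ A A) (c : Fin 3 → A) : Derivation ℂ A A :=
  c 0 • δ 0 + c 1 • δ 1 + c 2 • δ 2

lemma combDer_apply (δ : Fin 3 → Derivation ℂ A A) (c : Fin 3 → A) (f : A) :
    combDer δ c f = ∑ a, c a * δ a f := by
  simp [combDer, Fin.sum_univ_three]

lemma combDer_comm {δ : Fin 3 → Derivation ℂ A A} (hδc : ∀ a b f, δ a (δ b f) = δ b (δ a f))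
    (c d : Fin 3 → A) (f : A) : combDer δ c (combDer δ d f) - combDer δ d (combDer δ c f) =
      combDer δ (fun a => combDer δ c (d a) - combDer δ d (c a)) f := by
  simp only [combDer_apply, Fin.sum_univ_three, map_add, Derivation.leibniz, smul_eq_mul,
    hδc 1 0, hδc 2 0, hδc 2 1]
  ring

theorem structureJacobi_coordinates_inconsistent [StarRing A] [Nontrivial A]
    {δ : Fin 3 → Derivation ℂ A A} (hδs : ∀ a f, star (δ a f) = δ a (star f))
    (hδc : ∀ a b f, δ a (δ b f) = δ b (δ a f))
    (hprop : ∀ m : A, m * star m = 0 → m = 0)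
    (hpos : ∀ α b m : A, star α = α → IsUnit α → (α ^ 2 + 8 * (b * star b)) * m = 0 → m = 0)
    {i s κ u h : A} {Z : Fin 3 → A}
    (hiD : ∀ D : Derivation ℂ A A, D i = 0)
    (hsD : ∀ D : Derivation ℂ A A, D s = 0) (hκD : ∀ D : Derivation ℂ A A, D κ = 0)
    (huD : ∀ D : Derivation ℂ A A, D u = 0) (hhD : ∀ D : Derivation ℂ A A, D h = 0)
    (hi : i ^ 2 = -1) (his : star i = -i) (hu : u * κ = 1) (hh : 2 * h = 1)
    (hs : star s = s) (hs2 : s * s = 1) (hκs : star κ = κ) (ZZ : sesq s Z Z = 1)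
    (θ : Fin 3 → A) (V : Fin 3 → Fin 3 → A)
    (hθ : ∀ a, θ a = sesq s (fun j => δ a (Z j)) Z)
    (hV : ∀ a, V a = fun j => δ a (Z j) - θ a * Z j) (g g' : Matrix (Fin 3) (Fin 3) A)
    (hg : ∀ a b, g a b = h * u * (sesq s (V a) (V b) + sesq s (V b) (V a)))
    (hg' : g' * g = 1) {r : A} (hr : r ^ 2 * g.det = 1) (hrs : star r = r)
    (Γ : Fin 3 → Fin 3 → Fin 3 → A) (hΓs : ∀ k a b, star (Γ k a b) = Γ k a b)
    (hΓ : ∀ l a b, ∑ k, g l k * Γ k a b = h * (δ a (g b l) + δ b (g a l) - δ l (g a b)))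
    (om : Fin 3 → Fin 3 → A)
    (hom : ∀ a b, om a b = -i * h * u * (sesq s (V a) (V b) - sesq s (V b) (V a)))
    (x : Fin 3 → A) (hx0 : x 0 = r * om 1 2) (hx1 : x 1 = r * om 2 0) (hx2 : x 2 = r * om 0 1)
    (hR : ∀ k a, ∑ b, ∑ c, curvatureCoeff δ Γ k a b c * x b * x c = 0) : False := by
  have hus : star u = u := by
    have h1 := congrArg star hu
    rw [star_mul, hκs, star_one] at h1
    linear_combination u * h1 - star u * hu
  have hhs : star h = h := by
    have := congrArg star hh
    rw [star_mul, star_one, star_ofNat] at this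
    linear_combination h * this - star h * hh
  have VZ : ∀ a, sesq s (V a) Z = 0 := fun a => by
    rw [hV, sesq_sub_left, ZZ, hθ]; ring
  have hgs : ∀ a b, star (g a b) = g a b := fun a b => by
    simp only [hg, star_mul, star_add, hus, hhs, star_sesq hs]; ring
  have hgt : ∀ a b, g a b = g b a := fun a b => by rw [hg, hg, add_comm]
  have homs : ∀ a b, star (om a b) = om a b := fun a b => by
    simp only [hom, star_mul, star_sub, star_neg, hus, hhs, his, star_sesq hs]; ring
  have hxs : ∀ a, star (x a) = x a := fun a => by
    fin_cases a
    · simp [hx0, hrs, homs]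
    · simp [hx1, hrs, homs]
    · simp [hx2, hrs, homs]
  have hg's : ∀ a b, star (g' a b) = g' a b := fun a b => by
    have h1 : g'.map star * g = 1 := by
      ext a b
      have := congrArg star (congrFun (congrFun hg' a) b)
      simp only [Matrix.mul_apply, Fin.sum_univ_three, star_add, star_mul, hgs] at this
      simp only [Matrix.mul_apply, Fin.sum_univ_three, Matrix.map_apply]
      rw [show star ((1 : Matrix (Fin 3) (Fin 3) A) a b) = (1 : Matrix (Fin 3) (Fin 3) A) a b by
        rw [Matrix.one_apply]; split_ifs <;> simp only [star_one, star_zero]] at this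
      linear_combination this
    have h2 : g * g' = 1 := mul_eq_one_comm.1 hg'
    have h3 : g'.map star = g' := by
      rw [← mul_one (g'.map star), ← h2, ← mul_assoc, h1, one_mul]
    exact congrFun (congrFun h3 a) b
  obtain ⟨H, hH⟩ : ∃ H : Matrix (Fin 3) (Fin 3) A,
    H = Matrix.of fun a b => u * sesq s (V a) (V b) := ⟨_, rfl⟩
  have hHa : ∀ a b, H a b = u * sesq s (V a) (V b) := fun a b => by rw [hH, Matrix.of_apply]
  obtain ⟨hker, hker', hnorm⟩ := kernel_of_det_eq_zero hi hh H g (hH ▸ det_gram_eq_zero ZZ V VZ)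
    (fun a b => by rw [hHa, hHa, hg]; ring) hr om
    (fun a b => by rw [hHa, hHa, hom]; ring) x hx0 hx1 hx2
  obtain ⟨η, hη⟩ : ∃ η : Fin 3 → A, ∀ a, η a = ∑ b, g a b * x b := ⟨_, fun _ => rfl⟩
  simp only [← hη, hHa, mul_assoc, ← Finset.mul_sum] at hker hker'
  have hηs : ∀ a, star (η a) = η a := fun a => by
    simp only [hη, Fin.sum_univ_three, star_add, star_mul, hgs, hxs]; ring
  have hηx : ∑ a, x a * η a = 1 := by
    rw [← hnorm]
    simp only [hη, Fin.sum_univ_three]; ring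
  -- From ξ = -JN follows N = Jξ.
  obtain ⟨N, hN⟩ : ∃ N : Fin 3 → A, N = i • fun j => ∑ a, x a * V a j := ⟨_, rfl⟩
  have hVN : ∀ a, sesq s (V a) N = -i * κ * η a := fun a => by
    have := hker a
    rw [hN, sesq_smul_right, sesq_sum_mul_right, his]
    simp only [hxs, Fin.sum_univ_three] at this ⊢
    linear_combination -i * κ * this + i * (x 0 * sesq s (V a) (V 0) + x 1 * sesq s (V a) (V 1) +
      x 2 * sesq s (V a) (V 2)) * hu
  have hNV : ∀ a, sesq s N (V a) = i * κ * η a := fun a => by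
    rw [← star_sesq hs, hVN, star_mul, star_mul, star_neg, his, hκs, hηs]; ring
  have hNN : sesq s N N = κ := by
    conv_lhs => rw [hN, sesq_smul_left, sesq_sum_mul_left, ← hN]
    simp only [hVN, Fin.sum_univ_three] at hηx ⊢
    linear_combination (-i ^ 2 * κ) * hηx - κ * hi
  have hNZ : sesq s N Z = 0 := by
    rw [hN, sesq_smul_left, sesq_sum_mul_left]; simp [VZ]
  have hZN : sesq s Z N = 0 := by rw [← star_sesq hs, hNZ, star_zero]
  obtain ⟨E, hF⟩ := exists_isUnitaryFrame hs hs2 hκs (IsUnit.of_mul_eq_one u (by rw [mul_comm, hu]))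
    ZZ hNN hZN
  -- The coframe ε, ε̄, η; its dual frame consists of `t`, `star t` and `x`, and provides the
  -- derivations T, S and X.
  obtain ⟨ε, hε⟩ : ∃ ε : Fin 3 → A, ∀ a, ε a = u * sesq s (V a) E := ⟨_, fun _ => rfl⟩
  have hVexp : ∀ a j, V a j = ε a * E j - i * η a * N j := fun a j => by
    rw [hF.expand hu (V a) j, VZ, hVN, hε]
    linear_combination -i * η a * N j * hu
  have hVV : ∀ a b, u * sesq s (V a) (V b) = ε a * star (ε b) + η a * η b := fun a b => by
    have h1 : V a = ε a • E + (-i * η a) • N := funext fun j => by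
      rw [hVexp]; simp only [Pi.add_apply, Pi.smul_apply, smul_eq_mul]; ring
    have h2 : sesq s E (V b) = κ * star (ε b) := by
      rw [hε, star_mul, hus, star_sesq hs]
      linear_combination -sesq s E (V b) * hu
    rw [h1, sesq_add_left, sesq_smul_left, sesq_smul_left, h2, hNV]
    linear_combination (ε a * star (ε b) - i ^ 2 * η a * η b) * hu - η a * η b * hi
  obtain ⟨t, ht⟩ : ∃ t : Fin 3 → A, ∀ a, t a = h * ∑ b, g' a b * star (ε b) := ⟨_, fun _ => rfl⟩
  obtain ⟨⟨t₁, t₂, t₃⟩, ⟨t₁', t₂', t₃'⟩, ⟨x₁, x₂, x₃⟩, hdual⟩ :=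
    dual_basis (h := h) ε (fun a => star (ε a)) η g g' hg' (fun a b => by
      have h1 := hVV a b
      have h2 := hVV b a
      rw [hg]
      linear_combination h * h1 + h * h2 + η a * η b * hh) t (fun a => star (t a)) x ht
      (fun a => by
        simp only [ht, star_mul, Fin.sum_univ_three, star_add, hhs, hg's, star_star]; ring)
      (fun a => by
        have := congrFun (congrArg (fun m => Matrix.mulVec m x) hg') a
        simp only [← Matrix.mulVec_mulVec, Matrix.one_mulVec] at this
        rw [← this]
        simp only [Matrix.mulVec, dotProduct, hη])
  have sumV : ∀ (c : Fin 3 → A) j, ∑ a, c a * V a j =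
      (∑ a, c a * ε a) * E j - i * (∑ a, c a * η a) * N j := fun c j => by
    simp only [hVexp, Fin.sum_univ_three]; ring
  have htV : ∀ j, ∑ a, t a * V a j = E j := fun j => by rw [sumV, t₁, t₃]; ring
  have htV' : ∀ j, ∑ a, star (t a) * V a j = 0 := fun j => by rw [sumV, t₁', t₃']; ring
  have hxV : ∀ j, ∑ a, x a * V a j = -i * N j := fun j => by rw [sumV, x₁, x₃]; ring
  obtain ⟨ν, hν⟩ : ∃ ν : Fin 3 → A, ∀ a, ν a = -i * (u * sesq s (fun j => δ a (N j)) N - θ a) :=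
    ⟨_, fun _ => rfl⟩
  obtain ⟨B, hB⟩ : ∃ B : Fin 3 → A, ∀ a, B a = sesq s (fun j => δ a (N j)) E := ⟨_, fun _ => rfl⟩
  have gauss := gauss_equation hδs hδc hsD hκD huD hhD hi his hu hh hF θ V hθ hV g hg Γ hΓs hΓ t x
    hxs htV htV' hxV (fun a => by rw [hVN, hNV]; ring) hR ν B (fun a => sesq s (V a) E) hν hB
    fun _ => rfl
  -- the frame
  have combZ : ∀ (c : Fin 3 → A) j, combDer δ c (Z j) =
      (∑ a, c a * θ a) * Z j + ∑ a, c a * V a j := fun c j => by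
    simp only [combDer_apply, hV, Fin.sum_univ_three]; ring
  have comb_sesq : ∀ (c W : Fin 3 → A), sesq s (fun j => combDer δ c (N j)) W =
      ∑ a, c a * sesq s (fun j => δ a (N j)) W := fun c W => by
    simp only [combDer_apply]
    exact sesq_sum_mul_left s c (fun a j => δ a (N j)) W
  have comb_star : ∀ (c : Fin 3 → A) f, star (combDer δ c f) =
      combDer δ (fun a => star (c a)) (star f) := fun c f => by
    simp only [combDer_apply, Fin.sum_univ_three, star_add, star_mul, hδs]; ring
  have comb_expand : ∀ (c : Fin 3 → A) f, combDer δ c f = (∑ a, c a * η a) * combDer δ x f +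
      (∑ a, c a * ε a) * combDer δ t f +
      (∑ a, c a * star (ε a)) * combDer δ (fun a => star (t a)) f := fun c f => by
    have h0 := hdual c 0
    have h1 := hdual c 1
    have h2 := hdual c 2
    simp only [combDer_apply, Fin.sum_univ_three] at h0 h1 h2 ⊢
    linear_combination δ 0 f * h0 + δ 1 f * h1 + δ 2 f * h2
  have hνsum : ∀ c : Fin 3 → A, -i * (u * sesq s (fun j => combDer δ c (N j)) N - ∑ a, c a * θ a) =
      ∑ a, c a * ν a := fun c => by
    simp only [comb_sesq, hν, Fin.sum_univ_three]; ring
  have hBsum : ∀ c : Fin 3 → A, u * sesq s (fun j => combDer δ c (N j)) E =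
      u * ∑ a, c a * B a := fun c => by
    simp only [comb_sesq, hB]
  have gsum : ∀ c : Fin 3 → A, (∑ a, x a * ν a) * (u * ∑ a, c a * B a) =
      κ * (∑ a, c a * ε a) + (∑ a, c a * ν a) * (u * ∑ a, x a * B a) := fun c => by
    have h0 := gauss 0
    have h1 := gauss 1
    have h2 := gauss 2
    simp only [hε, Fin.sum_univ_three] at h0 h1 h2 ⊢
    linear_combination u * (c 0 * h0 + c 1 * h1 + c 2 * h2)
  refine unitary_frame_inconsistent (combDer δ x) (combDer δ t) (combDer δ fun a => star (t a))
    (fun f => by rw [comb_star]; simp only [hxs]) (comb_star t) hprop hpos hiD hκD hsD hi his hu hF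
    (aX := ∑ a, x a * θ a) (aT := ∑ a, t a * θ a) (aS := ∑ a, star (t a) * θ a)
    (fun j => by rw [combZ, hxV]; ring) (fun j => by rw [combZ, htV])
    (fun j => by rw [combZ, htV']; ring)
    (fun f => by rw [combDer_comm hδc, comb_expand])
    (fun f => by rw [combDer_comm hδc, comb_expand])
    rfl rfl rfl rfl rfl rfl ?_ ?_
  · rw [hνsum, hνsum, hBsum, hBsum, gsum, t₁, mul_one]
  · rw [hνsum, hνsum, hBsum, hBsum, gsum, t₁', mul_zero, zero_add]

end Hypersurface

/-! ### The differential ring of smooth functions on an open set -/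

section SmoothFunctions

/-- The complex-valued functions on `U` that are smooth in the real sense. -/
def smoothFun (U : Set E3) : StarSubalgebra ℂ (U → ℂ) where
  carrier := {f | ∃ F : E3 → ℂ, ContDiffOn ℝ ∞ F U ∧ ∀ y : U, f y = F y}
  mul_mem' := by
    rintro f g ⟨F, hF, hf⟩ ⟨G, hG, hg⟩
    exact ⟨fun y => F y * G y, hF.mul hG, fun y => by simp [hf, hg]⟩
  add_mem' := by
    rintro f g ⟨F, hF, hf⟩ ⟨G, hG, hg⟩
    exact ⟨fun y => F y + G y, hF.add hG, fun y => by simp [hf, hg]⟩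
  algebraMap_mem' c := ⟨fun _ => c, contDiffOn_const, fun y => rfl⟩
  star_mem' := by
    rintro f ⟨F, hF, hf⟩
    exact ⟨fun y => conj (F y), Complex.conjCLE.contDiff.comp_contDiffOn hF, fun y => by
      simp [hf]⟩

variable {U : Set E3}

instance : CoeFun (smoothFun U) fun _ => U → ℂ := ⟨fun f => f.1⟩

@[ext] lemma smoothFun.ext {f g : smoothFun U} (h : ∀ y, f y = g y) : f = g :=
  Subtype.ext (funext h)

@[simp] lemma smoothFun.add_apply (f g : smoothFun U) (y : U) : (f + g) y = f y + g y := rfl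
@[simp] lemma smoothFun.mul_apply (f g : smoothFun U) (y : U) : (f * g) y = f y * g y := rfl
@[simp] lemma smoothFun.sub_apply (f g : smoothFun U) (y : U) : (f - g) y = f y - g y := rfl
@[simp] lemma smoothFun.neg_apply (f : smoothFun U) (y : U) : (-f) y = -f y := rfl
@[simp] lemma smoothFun.one_apply (y : U) : (1 : smoothFun U) y = 1 := rfl
@[simp] lemma smoothFun.zero_apply (y : U) : (0 : smoothFun U) y = 0 := rfl
@[simp] lemma smoothFun.pow_apply (f : smoothFun U) (n : ℕ) (y : U) : (f ^ n) y = f y ^ n := rfl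
@[simp] lemma smoothFun.smul_apply (c : ℂ) (f : smoothFun U) (y : U) : (c • f) y = c * f y := rfl
@[simp] lemma smoothFun.star_apply (f : smoothFun U) (y : U) : (star f) y = conj (f y) := rfl

/-- Evaluation at a point. -/
def smoothFun.eval (y : U) : smoothFun U →+* ℂ where
  toFun f := f y
  map_one' := rfl
  map_mul' _ _ := rfl
  map_zero' := rfl
  map_add' _ _ := rfl

@[simp] lemma smoothFun.eval_apply (y : U) (f : smoothFun U) : smoothFun.eval y f = f y := rfl

lemma smoothFun.sum_apply {ι : Type*} (s : Finset ι) (f : ι → smoothFun U) (y : U) :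
    (∑ i ∈ s, f i) y = ∑ i ∈ s, f i y := map_sum (smoothFun.eval y) f s

/-- The extension by zero. -/
def zeroExt (f : smoothFun U) : E3 → ℂ := Function.extend Subtype.val f.1 0

lemma zeroExt_apply (f : smoothFun U) (y : U) : zeroExt f y = f y :=
  Subtype.val_injective.extend_apply _ _ _

lemma zeroExt_contDiffOn (f : smoothFun U) : ContDiffOn ℝ ∞ (zeroExt f) U := by
  obtain ⟨F, hF, h⟩ := f.2
  exact hF.congr fun y hy => by rw [zeroExt_apply f ⟨y, hy⟩]; exact h ⟨y, hy⟩

/-- Since `U` is open, derivatives at its points do not depend on the extension chosen. -/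
lemma smoothFun.eventuallyEq (hU : IsOpen U) {f : smoothFun U} {F : E3 → ℂ}
    (h : ∀ y : U, f y = F y) (y : U) : (zeroExt f) =ᶠ[nhds y.1] F := by
  filter_upwards [hU.mem_nhds y.2] with z hz
  rw [zeroExt_apply f ⟨z, hz⟩, h]

/-- A function that is smooth on `U`. -/
def smoothFun.of (F : E3 → ℂ) (hF : ContDiffOn ℝ ∞ F U) : smoothFun U :=
  ⟨fun y => F y, F, hF, fun _ => rfl⟩

@[simp] lemma smoothFun.of_apply (F : E3 → ℂ) (hF : ContDiffOn ℝ ∞ F U) (y : U) :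
    smoothFun.of F hF y = F y := rfl

lemma smoothFun.differentiableAt (hU : IsOpen U) (f : smoothFun U) (y : U) :
    DifferentiableAt ℝ (zeroExt f) y :=
  ((zeroExt_contDiffOn f).contDiffAt (hU.mem_nhds y.2)).differentiableAt (by simp)

/-- The partial derivative of a smooth function on an open set. -/
def partialDer (hU : IsOpen U) (a : Fin 3) : Derivation ℂ (smoothFun U) (smoothFun U) :=
  Derivation.mk'
    { toFun := fun f => smoothFun.of (fun y => fderiv ℝ (zeroExt f) y (EuclideanSpace.single a 1))
        (((zeroExt_contDiffOn f).fderiv_of_isOpen hU (m := ∞) (by simp)).clm_apply contDiffOn_const)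
      map_add' := fun f g => by
        ext y
        have h : (zeroExt (f + g)) =ᶠ[nhds y.1] fun z => zeroExt f z + zeroExt g z :=
          smoothFun.eventuallyEq hU (fun y => by simp [zeroExt_apply]) y
        simp only [smoothFun.of_apply, smoothFun.add_apply]
        rw [h.fderiv_eq, fderiv_fun_add (smoothFun.differentiableAt hU f y)
          (smoothFun.differentiableAt hU g y)]
        rfl
      map_smul' := fun c f => by
        ext y
        have h : (zeroExt (c • f)) =ᶠ[nhds y.1] fun z => c * zeroExt f z :=
          smoothFun.eventuallyEq hU (fun y => by simp [zeroExt_apply]) y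
        simp only [smoothFun.of_apply, smoothFun.smul_apply, RingHom.id_apply]
        rw [h.fderiv_eq, fderiv_const_mul (smoothFun.differentiableAt hU f y)]
        rfl }
    fun f g => by
      ext y
      have h : (zeroExt (f * g)) =ᶠ[nhds y.1] fun z => zeroExt f z * zeroExt g z :=
        smoothFun.eventuallyEq hU (fun y => by simp [zeroExt_apply]) y
      simp only [LinearMap.coe_mk, AddHom.coe_mk, smoothFun.of_apply, smoothFun.add_apply,
        smul_eq_mul, smoothFun.mul_apply]
      rw [h.fderiv_eq, fderiv_fun_mul (smoothFun.differentiableAt hU f y)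
          (smoothFun.differentiableAt hU g y)]
      simp [zeroExt_apply]

lemma partialDer_apply (hU : IsOpen U) (a : Fin 3) (f : smoothFun U) (y : U) :
    partialDer hU a f y = fderiv ℝ (zeroExt f) y (EuclideanSpace.single a 1) := rfl

lemma partialDer_eq_fderiv (hU : IsOpen U) (a : Fin 3) {f : smoothFun U} {F : E3 → ℂ}
    (h : ∀ y : U, f y = F y) (y : U) :
    partialDer hU a f y = fderiv ℝ F y (EuclideanSpace.single a 1) := by
  rw [partialDer_apply, (smoothFun.eventuallyEq hU h y).fderiv_eq]

lemma partialDer_eq_pd (hU : IsOpen U) (a : Fin 3) {f : smoothFun U} {F : E3 → ℝ}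
    (h : ∀ y : U, f y = F y) (y : U) : partialDer hU a f y = pd a F y := by
  have h1 : F =ᶠ[nhds y.1] fun z => (zeroExt f z).re := by
    filter_upwards [hU.mem_nhds y.2] with z hz
    rw [zeroExt_apply f ⟨z, hz⟩, h, Complex.ofReal_re]
  have h2 : DifferentiableAt ℝ F y :=
    (Complex.reCLM.differentiableAt.comp _
      (smoothFun.differentiableAt hU f y)).congr_of_eventuallyEq h1
  rw [partialDer_eq_fderiv hU a (F := fun y => (F y : ℂ)) h, pd]
  have h3 := Complex.ofRealCLM.hasFDerivAt.comp y.1 h2.hasFDerivAt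
  have h4 : HasFDerivAt (fun y => (F y : ℂ)) _ y.1 := h3
  rw [h4.fderiv]
  simp

lemma star_partialDer (hU : IsOpen U) (a : Fin 3) (f : smoothFun U) :
    star (partialDer hU a f) = partialDer hU a (star f) := by
  ext y
  have h1 : HasFDerivAt (fun z => conj (zeroExt f z)) _ y.1 :=
    (Complex.conjCLE.toContinuousLinearMap.hasFDerivAt).comp y.1
      (smoothFun.differentiableAt hU f y).hasFDerivAt
  rw [partialDer_eq_fderiv hU a (F := fun z => conj (zeroExt f z))
    (fun y => by simp [zeroExt_apply]), h1.fderiv]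
  simp [partialDer_apply]

lemma partialDer_comm (hU : IsOpen U) (a b : Fin 3) (f : smoothFun U) :
    partialDer hU a (partialDer hU b f) = partialDer hU b (partialDer hU a f) := by
  ext y
  have hd : DifferentiableAt ℝ (fderiv ℝ (zeroExt f)) y :=
    (((zeroExt_contDiffOn f).fderiv_of_isOpen hU (m := ∞) (by simp)).contDiffAt
      (hU.mem_nhds y.2)).differentiableAt (by simp)
  have key : ∀ a b, partialDer hU a (partialDer hU b f) y =
      fderiv ℝ (fderiv ℝ (zeroExt f)) y (EuclideanSpace.single a 1)
        (EuclideanSpace.single b 1) := by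
    intro a b
    rw [partialDer_eq_fderiv hU a (F := fun z => fderiv ℝ (zeroExt f) z (EuclideanSpace.single b 1))
      (fun y => partialDer_apply hU b f y)]
    rw [fderiv_clm_apply hd (differentiableAt_const _)]
    simp
  rw [key, key]
  have hc := (zeroExt_contDiffOn f).contDiffAt (hU.mem_nhds y.2)
  exact (hc.isSymmSndFDerivAt (by
    rw [minSmoothness_of_isRCLikeNormedField]
    exact WithTop.coe_le_coe.2 (le_top : (2 : ℕ∞) ≤ ⊤))).eq _ _

lemma smoothFun.isUnit (f : smoothFun U) (h : ∀ y, f y ≠ 0) : IsUnit f := by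
  refine IsUnit.of_mul_eq_one (smoothFun.of (fun y => (zeroExt f y)⁻¹)
    ((zeroExt_contDiffOn f).inv fun y hy => by rw [zeroExt_apply f ⟨y, hy⟩]; exact h ⟨y, hy⟩)) ?_
  ext y
  simp [zeroExt_apply, h]

lemma smoothFun.exists_inv_sqrt (f : smoothFun U) (h : ∀ y, 0 < (f y).re)
    (hs : star f = f) : ∃ r : smoothFun U, star r = r ∧ r ^ 2 * f = 1 ∧
      ∀ y, r y = ((√(f y).re)⁻¹ : ℝ) := by
  have hpos : ∀ y ∈ U, 0 < (zeroExt f y).re := fun y hy => by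
    rw [zeroExt_apply f ⟨y, hy⟩]; exact h _
  have hre : ContDiffOn ℝ ∞ (fun y => (zeroExt f y).re) U :=
    Complex.reCLM.contDiff.comp_contDiffOn (zeroExt_contDiffOn f)
  have hsm : ContDiffOn ℝ ∞ (fun y => (√(zeroExt f y).re)⁻¹) U :=
    (hre.sqrt fun y hy => (hpos y hy).ne').inv fun y hy => (Real.sqrt_pos.2 (hpos y hy)).ne'
  have hsm' : ContDiffOn ℝ ∞ (fun y => ((√(zeroExt f y).re)⁻¹ : ℂ)) U := by
    simpa only [Function.comp_def, Complex.ofRealCLM_apply, Complex.ofReal_inv] using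
      Complex.ofRealCLM.contDiff.comp_contDiffOn hsm
  refine ⟨smoothFun.of _ hsm', ?_, ?_, fun y => ?_⟩
  · ext y
    simp only [smoothFun.star_apply, smoothFun.of_apply, map_inv₀, Complex.conj_ofReal]
  · ext y
    have h1 : ((f y).re : ℂ) = f y := by
      have := congrArg (fun g : smoothFun U => g y) hs
      exact Complex.conj_eq_iff_re.1 this
    have h2 := Real.sqrt_pos.2 (h y)
    simp only [smoothFun.mul_apply, smoothFun.pow_apply, smoothFun.of_apply,
      zeroExt_apply, smoothFun.one_apply]
    rw [← h1, Complex.ofReal_re, ← Complex.ofReal_inv, ← Complex.ofReal_pow,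
      ← Complex.ofReal_mul, inv_pow,
      Real.sq_sqrt (h y).le, inv_mul_cancel₀ (h y).ne', Complex.ofReal_one]
  · simp only [smoothFun.of_apply, zeroExt_apply, Complex.ofReal_inv]

lemma smoothFun.eq_zero_of_mul_star (m : smoothFun U) (h : m * star m = 0) : m = 0 := by
  ext y
  have := congrArg (fun g : smoothFun U => g y) h
  simpa using this

/-- At each point α is a non-zero real number and b b̄ is non-negative, so the factor is positive.
-/
lemma smoothFun.eq_zero_of_pos_mul (α b m : smoothFun U) (hα : star α = α) (hu : IsUnit α)
    (h : (α ^ 2 + 8 * (b * star b)) * m = 0) : m = 0 := by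
  ext y
  have h0 : α y ≠ 0 := (hu.map (smoothFun.eval y)).ne_zero
  have h1 : ((α y).re : ℂ) = α y :=
    Complex.conj_eq_iff_re.1 (congrArg (fun g : smoothFun U => g y) hα)
  have h2 : (α y ^ 2 + 8 * (b y * conj (b y))) * m y = 0 := congrArg (smoothFun.eval y) h
  rcases mul_eq_zero.1 h2 with h3 | h3
  · exfalso
    rw [← h1, Complex.mul_conj] at h3
    have h4 : (α y).re ^ 2 + 8 * Complex.normSq (b y) = 0 := by exact_mod_cast h3
    have h5 : (α y).re ≠ 0 := fun h => h0 (by rw [← h1, h, Complex.ofReal_zero])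
    have := Complex.normSq_nonneg (b y)
    have : 0 < (α y).re ^ 2 := by positivity
    linarith
  · exact h3

end SmoothFunctions

/-! ### A lift to ℂ³ over a coordinate domain -/

section Local

/-- The Hermitian extension of the metric of the space form, on vectors `u, v` at `[z]`. -/
def gramForm (c : ℝ) (z u v : Fin 3 → ℂ) : ℂ :=
  ((4 / c : ℝ) : ℂ) * ((herm c u v * herm c z z - herm c u z * herm c z v) / herm c z z ^ 2)

lemma herm_conj (c : ℝ) (u v : Fin 3 → ℂ) : conj (herm c u v) = herm c v u :=
  star_sesq (Complex.conj_ofReal _) u v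

lemma gramForm_conj (c : ℝ) (z u v : Fin 3 → ℂ) : conj (gramForm c z u v) = gramForm c z v u := by
  simp only [gramForm, map_mul, map_div₀, map_sub, map_pow, herm_conj, Complex.conj_ofReal]
  ring

/-- The vector spanning the kernel of the imaginary part of a Hermitian `3 × 3` matrix, divided by
the square root of `d`. -/
def kernelVec (H : Fin 3 → Fin 3 → ℂ) (d : ℝ) : E3 :=
  WithLp.toLp 2 ![(√d)⁻¹ * (H 1 2).im, (√d)⁻¹ * (H 2 0).im, (√d)⁻¹ * (H 0 1).im]

lemma sign_mul_sign {c : ℝ} (hc : c ≠ 0) : Real.sign c * Real.sign c = 1 := by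
  rcases lt_or_gt_of_ne hc with h | h
  · rw [Real.sign_of_neg h]; norm_num
  · rw [Real.sign_of_pos h]; norm_num

/-- The vector `∂_a z` in `ℂ³`. -/
def liftDeriv (z : Fin 3 → E3 → ℂ) (a : Fin 3) (y : E3) : Fin 3 → ℂ :=
  fun j => fderiv ℝ (z j) y (EuclideanSpace.single a 1)

theorem local_hypersurface_inconsistent {c : ℝ} (hc : c ≠ 0) {U : Set E3} (hU : IsOpen U)
    (hne : U.Nonempty) (z : Fin 3 → E3 → ℂ) (hz : ∀ j, ContDiffOn ℝ ∞ (z j) U)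
    (hpos : ∀ y ∈ U, 0 < (herm c (fun j => z j y) (fun j => z j y)).re)
    (g : E3 → Matrix (Fin 3) (Fin 3) ℝ)
    (hg : ∀ y ∈ U, ∀ a b,
      g y a b = (gramForm c (fun j => z j y) (liftDeriv z a y) (liftDeriv z b y)).re)
    (hdet : ∀ y ∈ U, 0 < (g y).det)
    (hR : ∀ y ∈ U, ∀ a, ∀ x, x = kernelVec (fun a b =>
        gramForm c (fun j => z j y) (liftDeriv z a y) (liftDeriv z b y)) (g y).det →
      riemann g y (EuclideanSpace.single a 1) x x = 0) : False := by
  have : Nonempty U := hne.to_subtype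
  have : Nontrivial (smoothFun U) := (smoothFun.eval (Classical.arbitrary U)).domain_nontrivial
  let δ := partialDer hU
  let C : ℂ →+* smoothFun U := algebraMap ℂ (smoothFun U)
  have hC : ∀ (D : Derivation ℂ (smoothFun U) (smoothFun U)) (w : ℂ), D (C w) = 0 :=
    fun D w => D.map_algebraMap w
  have hCs : ∀ w : ℂ, star (C w) = C (conj w) := fun w => (algebraMap_star_comm w).symm
  have hCa : ∀ (w : ℂ) (y : U), C w y = w := fun w y => rfl
  let s : smoothFun U := C (Real.sign c : ℝ)
  have hss : star s = s := by rw [hCs, Complex.conj_ofReal]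
  let zr : Fin 3 → smoothFun U := fun j => smoothFun.of (z j) (hz j)
  have hev : ∀ (u v : Fin 3 → smoothFun U) (y : U),
      sesq s u v y = herm c (fun j => u j y) (fun j => v j y) := fun u v y => rfl
  obtain ⟨m, hms, hm, -⟩ := smoothFun.exists_inv_sqrt (sesq s zr zr)
    (fun y => hpos y y.2) (star_sesq hss _ _)
  let Z : Fin 3 → smoothFun U := fun j => m * zr j
  -- The metric is 4/c times the Hermitian form on horizontal vectors, so metric unit vectors have
  -- Hermitian square c/4.
  let κ : smoothFun U := C ((c / 4 : ℝ) : ℂ)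
  let u : smoothFun U := C ((4 / c : ℝ) : ℂ)
  let h : smoothFun U := C (1 / 2)
  let i : smoothFun U := C Complex.I
  have hu : u * κ = 1 := by
    rw [← map_mul, ← Complex.ofReal_mul, ← map_one C]
    congr 1
    rw [div_mul_div_comm, mul_comm, div_self (by simp [hc]), Complex.ofReal_one]
  have hh : 2 * h = 1 := by
    rw [← map_ofNat C 2, ← map_mul, ← map_one C]
    norm_num
  have hi : i ^ 2 = -1 := by
    rw [← map_pow, Complex.I_sq, map_neg, map_one]
  have his : star i = -i := by rw [hCs, Complex.conj_I, map_neg]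
  have hZm : Z = m • zr := rfl
  have ZZ : sesq s Z Z = 1 := by
    rw [hZm, sesq_smul_left, sesq_smul_right, hms, ← hm]; ring
  let θ : Fin 3 → smoothFun U := fun a => sesq s (fun j => δ a (Z j)) Z
  let V : Fin 3 → Fin 3 → smoothFun U := fun a j => δ a (Z j) - θ a * Z j
  let dz : Fin 3 → Fin 3 → smoothFun U := fun a j => δ a (zr j)
  -- The derivative of the normalizing factor `m` contributes a multiple of `Z`, which the
  -- projection removes.
  have hV : ∀ a, V a = m • fun j => dz a j - (m ^ 2 * sesq s (dz a) zr) * zr j := fun a => by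
    have h1 : (fun j => δ a (Z j)) = m • dz a + δ a m • zr := funext fun j => by
      simp only [Z, dz, Derivation.leibniz, smul_eq_mul, Pi.add_apply, Pi.smul_apply]
      ring
    have h2 : θ a = m ^ 2 * sesq s (dz a) zr + δ a m * m * sesq s zr zr := by
      simp only [θ]
      rw [h1, hZm, sesq_smul_right, sesq_add_left, sesq_smul_left, sesq_smul_left, hms]
      ring
    funext j
    have h3 := congrFun h1 j
    simp only [V, Pi.add_apply, Pi.smul_apply, smul_eq_mul] at h3 ⊢
    rw [h3, h2]
    simp only [Z]
    linear_combination (-(δ a m * zr j)) * hm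
  have hmz : ∀ y : U, m y ^ 2 * herm c (fun j => z j y) (fun j => z j y) = 1 := fun y =>
    congrArg (smoothFun.eval y) hm
  have hdz : ∀ a (y : U), (fun j => dz a j y) = liftDeriv z a y := fun a y =>
    funext fun j => partialDer_eq_fderiv hU a (fun _ => rfl) y
  have hVV : ∀ a b (y : U), (u * sesq s (V a) (V b)) y =
      gramForm c (fun j => z j y) (liftDeriv z a y) (liftDeriv z b y) := fun a b y => by
    have h1 : sesq s (V a) (V b) = m ^ 2 * (sesq s (dz a) (dz b) -
        m ^ 2 * sesq s (dz a) zr * sesq s zr (dz b)) := by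
      have e1 : star (m ^ 2 * sesq s (dz b) zr) = m ^ 2 * sesq s zr (dz b) := by
        rw [star_mul, star_pow, hms, star_sesq hss]; ring
      rw [hV, hV, sesq_smul_left, sesq_smul_right, hms, sesq_sub_left, sesq_sub_right,
        sesq_sub_right, e1]
      linear_combination (m ^ 4 * sesq s (dz a) zr * sesq s zr (dz b)) * hm
    have h2 := hmz y
    have h3 : herm c (fun j => z j y) (fun j => z j y) ≠ 0 :=
      right_ne_zero_of_mul (by rw [h2]; simp)
    have h4 : m y ^ 2 = (herm c (fun j => z j y) (fun j => z j y))⁻¹ := eq_inv_of_mul_eq_one_left h2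
    rw [h1]
    simp only [smoothFun.mul_apply, smoothFun.sub_apply, smoothFun.pow_apply, hev, hdz, h4]
    simp only [u, hCa, zr, smoothFun.of_apply, gramForm]
    field_simp
  let gm : Matrix (Fin 3) (Fin 3) (smoothFun U) :=
    Matrix.of fun a b => h * u * (sesq s (V a) (V b) + sesq s (V b) (V a))
  have hgm : ∀ a b (y : U), gm a b y = (g y a b : ℂ) := fun a b y => by
    have h1 : gm a b = h * (u * sesq s (V a) (V b) + u * sesq s (V b) (V a)) := by
      simp only [gm, Matrix.of_apply]; ring
    rw [h1, smoothFun.mul_apply, smoothFun.add_apply, hVV, hVV, hg y y.2,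
      ← gramForm_conj c _ (liftDeriv z a y), Complex.add_conj]
    simp only [h, hCa]
    push_cast
    ring
  have hmap : ∀ y : U, (smoothFun.eval y).mapMatrix gm = Complex.ofRealHom.mapMatrix (g y) :=
    fun y => Matrix.ext fun a b => hgm a b y
  have hgdet : ∀ y : U, gm.det y = ((g y).det : ℂ) := fun y => by
    rw [← smoothFun.eval_apply, RingHom.map_det, hmap, ← RingHom.map_det]
    rfl
  have hunit : IsUnit gm.det := smoothFun.isUnit _ fun y => by
    rw [hgdet]
    exact_mod_cast (hdet y y.2).ne'
  have hdets : star gm.det = gm.det := by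
    ext y
    rw [smoothFun.star_apply, hgdet, Complex.conj_ofReal]
  obtain ⟨r, hrs, hr, hreval⟩ := smoothFun.exists_inv_sqrt gm.det
    (fun y => by rw [hgdet, Complex.ofReal_re]; exact hdet y y.2) hdets
  have hg' : gm⁻¹ * gm = 1 := Matrix.nonsing_inv_mul _ hunit
  have hg'' : gm * gm⁻¹ = 1 := Matrix.mul_nonsing_inv _ hunit
  have hginv : ∀ a b (y : U), gm⁻¹ a b y = ((g y)⁻¹ a b : ℂ) := fun a b y => by
    have h1 : (smoothFun.eval y).mapMatrix gm⁻¹ * Complex.ofRealHom.mapMatrix (g y) = 1 := by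
      rw [← hmap, ← map_mul, hg', map_one]
    have h2 : Complex.ofRealHom.mapMatrix (g y)⁻¹ * Complex.ofRealHom.mapMatrix (g y) = 1 := by
      rw [← map_mul, Matrix.nonsing_inv_mul _ (isUnit_iff_ne_zero.2 (hdet y y.2).ne'), map_one]
    have h3 := (Matrix.inv_eq_left_inv h1).symm.trans (Matrix.inv_eq_left_inv h2)
    exact congrFun (congrFun h3 a) b
  let Γ : Fin 3 → Fin 3 → Fin 3 → smoothFun U := fun k a b =>
    h * ∑ l, gm⁻¹ k l * (δ a (gm b l) + δ b (gm a l) - δ l (gm a b))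
  have hδg : ∀ a b d (y : U), δ a (gm b d) y = (pd a (fun w => g w b d) y : ℂ) :=
    fun a b d y => partialDer_eq_pd hU a (F := fun w => g w b d) (hgm b d) y
  have hΓeval : ∀ k a b (y : U), Γ k a b y = (christoffel g k a b y : ℂ) := fun k a b y => by
    simp only [Γ, christoffel, smoothFun.mul_apply, smoothFun.sum_apply, smoothFun.sub_apply,
      smoothFun.add_apply, hδg, hginv, h, hCa]
    push_cast
    rfl
  have hΓs : ∀ k a b, star (Γ k a b) = Γ k a b := fun k a b => by
    ext y
    rw [smoothFun.star_apply, hΓeval, Complex.conj_ofReal]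
  have hΓ : ∀ l a b, ∑ k, gm l k * Γ k a b =
      h * (δ a (gm b l) + δ b (gm a l) - δ l (gm a b)) := fun l a b => by
    have h1 := congrFun (Matrix.mulVec_mulVec
      (fun l => δ a (gm b l) + δ b (gm a l) - δ l (gm a b)) gm gm⁻¹) l
    rw [hg'', Matrix.one_mulVec] at h1
    rw [← h1]
    simp only [Γ, Matrix.mulVec, dotProduct, Finset.mul_sum]
    exact Finset.sum_congr rfl fun _ _ => Finset.sum_congr rfl fun _ _ => by ring
  have hcurv : ∀ k a b d (y : U), curvatureCoeff δ Γ k a b d y = (riemannCoeff g k a b d y : ℂ) :=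
    fun k a b d y => by
    simp only [curvatureCoeff, riemannCoeff, smoothFun.add_apply, smoothFun.sub_apply,
      smoothFun.sum_apply, smoothFun.mul_apply, hΓeval, δ,
      partialDer_eq_pd hU a (hΓeval k b d) y, partialDer_eq_pd hU b (hΓeval k a d) y]
    push_cast
    rfl
  let om : Fin 3 → Fin 3 → smoothFun U := fun a b =>
    -i * h * u * (sesq s (V a) (V b) - sesq s (V b) (V a))
  have homeval : ∀ a b (y : U), om a b y =
      ((gramForm c (fun j => z j y) (liftDeriv z a y) (liftDeriv z b y)).im : ℂ) := fun a b y => by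
    have h1 : om a b = -i * h * (u * sesq s (V a) (V b) - u * sesq s (V b) (V a)) := by
      simp only [om]; ring
    rw [h1, smoothFun.mul_apply, smoothFun.sub_apply, hVV, hVV,
      ← gramForm_conj c _ (liftDeriv z a y), Complex.sub_conj]
    simp only [h, i, hCa, smoothFun.mul_apply, smoothFun.neg_apply]
    push_cast
    linear_combination
      (-((gramForm c (fun j => z j y) (liftDeriv z a y) (liftDeriv z b y)).im : ℂ)) *
        Complex.I_mul_I
  let x : Fin 3 → smoothFun U := ![r * om 1 2, r * om 2 0, r * om 0 1]
  have hxeval : ∀ a (y : U), x a y = (kernelVec (fun a b => gramForm c (fun j => z j y)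
      (liftDeriv z a y) (liftDeriv z b y)) (g y).det a : ℂ) := fun a y => by
    have h1 : r y = ((√(g y).det)⁻¹ : ℝ) := by rw [hreval, hgdet, Complex.ofReal_re]
    fin_cases a <;> simp [x, kernelVec, homeval, h1]
  refine structureJacobi_coordinates_inconsistent (δ := δ) (star_partialDer hU)
    (partialDer_comm hU) smoothFun.eq_zero_of_mul_star smoothFun.eq_zero_of_pos_mul
    (i := i) (s := s) (κ := κ) (u := u) (h := h) (Z := Z) (fun D => hC D _) (fun D => hC D _)
    (fun D => hC D _) (fun D => hC D _) (fun D => hC D _) hi his hu hh hss ?_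
    (by rw [hCs, Complex.conj_ofReal]) ZZ θ V (fun _ => rfl) (fun _ => rfl) gm gm⁻¹
    (fun _ _ => rfl) hg' hr hrs Γ hΓs hΓ om (fun _ _ => rfl) x rfl rfl rfl ?_
  · rw [← map_mul, ← Complex.ofReal_mul, sign_mul_sign hc, Complex.ofReal_one, map_one]
  · intro k a
    ext y
    have h1 := congrArg (fun v : E3 => v k) (hR y y.2 a _ rfl)
    simp only [riemann, PiLp.zero_apply] at h1
    rw [Finset.sum_eq_single a (fun b _ hb => by simp [hb]) (by simp)] at h1
    simp only [smoothFun.sum_apply, smoothFun.mul_apply, hcurv, hxeval, smoothFun.zero_apply]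
    simp only [PiLp.single_apply, if_true, mul_one] at h1
    exact_mod_cast h1

end Local

/-! ### The Hermitian metric in homogeneous coordinates -/

section Gram

/-- Independence of the lift. It is needed because `homCoord` uses a point-dependent chart, whereas
the smooth lift uses a fixed one. -/
lemma gramForm_smul_add (c : ℝ) (z u v : Fin 3 → ℂ) {l : ℂ} (hl : l ≠ 0) (b d : ℂ) :
    gramForm c (l • z) (l • u + b • z) (l • v + d • z) = gramForm c z u v := by
  have h1 : herm c (l • u + b • z) (l • v + d • z) * herm c (l • z) (l • z) -
      herm c (l • u + b • z) (l • z) * herm c (l • z) (l • v + d • z) =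
      (l * conj l) ^ 2 * (herm c u v * herm c z z - herm c u z * herm c z v) := by
    simp only [herm, Pi.add_apply, Pi.smul_apply, smul_eq_mul, map_add, map_mul]
    ring
  have h2 : herm c (l • z) (l • z) ^ 2 = (l * conj l) ^ 2 * herm c z z ^ 2 := by
    simp only [herm, Pi.smul_apply, smul_eq_mul, map_mul]
    ring
  rw [gramForm, h1, h2, mul_div_mul_left, gramForm]
  simpa using hl

lemma gramForm_smul_sum_left (c : ℝ) (z v : Fin 3 → ℂ) (w : ℂ) (u : Fin 3 → Fin 3 → ℂ)
    (x : Fin 3 → ℝ) :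
    gramForm c z (w • ∑ a, x a • u a) v = w * ∑ a, x a * gramForm c z (u a) v := by
  simp only [gramForm, herm, Fin.sum_univ_three, Pi.add_apply, Pi.smul_apply, smul_eq_mul,
    Complex.real_smul]
  ring

lemma gramForm_sum_right (c : ℝ) (z v : Fin 3 → ℂ) (u : Fin 3 → Fin 3 → ℂ) (x : Fin 3 → ℝ) :
    gramForm c z v (∑ a, x a • u a) = ∑ a, x a * gramForm c z v (u a) := by
  simp only [gramForm, herm, Fin.sum_univ_three, Pi.add_apply, Pi.smul_apply,
    Complex.real_smul, map_add, map_mul, Complex.conj_ofReal]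
  ring

lemma gramForm_I_smul (c : ℝ) (z u v : Fin 3 → ℂ) :
    gramForm c z (Complex.I • u) (Complex.I • v) = gramForm c z u v := by
  have h : herm c (Complex.I • u) (Complex.I • v) * herm c z z -
      herm c (Complex.I • u) z * herm c z (Complex.I • v) =
      herm c u v * herm c z z - herm c u z * herm c z v := by
    have hl : ∀ w, herm c (Complex.I • u) w = Complex.I * herm c u w := fun w => by
      simp only [herm, Pi.smul_apply, smul_eq_mul]; ring
    have hr : ∀ w, herm c w (Complex.I • v) = -Complex.I * herm c w v := fun w => by
      simp only [herm, Pi.smul_apply, smul_eq_mul, map_mul, Complex.conj_I]; ring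
    rw [hl, hr, hl, hr]
    linear_combination (-(herm c u v * herm c z z - herm c u z * herm c z v)) * Complex.I_sq
  rw [gramForm, h, gramForm]

lemma herm_self (c : ℝ) (z : Fin 3 → ℂ) : herm c z z = (((herm c z z).re : ℝ) : ℂ) :=
  (Complex.conj_eq_iff_re.1 (herm_conj c z z)).symm

/-- By Lagrange's identity the numerator is sgn(c)(|p|² + |q|²) + |r|² in the 2 × 2 minors of u and
z. These do not all vanish, as `hzi` and `hui` make u and z independent. For c < 0 the sign comes
from z₀ r = z₁ q - z₂ p and |z₁|² + |z₂|² < |z₀|². -/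
lemma gramForm_self_re_pos {c : ℝ} (hc : c ≠ 0) {z u : Fin 3 → ℂ} (hz : 0 < (herm c z z).re)
    {i : Fin 3} (hzi : z i = 1) (hui : u i = 0) (hu : u ≠ 0) : 0 < (gramForm c z u u).re := by
  set p := u 0 * z 1 - u 1 * z 0 with hp
  set q := u 0 * z 2 - u 2 * z 0 with hq
  set r := u 1 * z 2 - u 2 * z 1 with hr
  have hs : ((Real.sign c : ℝ) : ℂ) * (Real.sign c : ℝ) = 1 := by
    exact_mod_cast sign_mul_sign hc
  have h1 : herm c u u * herm c z z - herm c u z * herm c z u =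
      ((Real.sign c * (Complex.normSq p + Complex.normSq q) + Complex.normSq r : ℝ) : ℂ) := by
    push_cast
    rw [← Complex.mul_conj, ← Complex.mul_conj, ← Complex.mul_conj, hp, hq, hr]
    simp only [herm, map_sub, map_mul]
    linear_combination
      ((u 1 * z 2 - u 2 * z 1) * (conj (u 1) * conj (z 2) - conj (u 2) * conj (z 1))) * hs
  have h2 : (gramForm c z u u).re = 4 / c *
      (Real.sign c * (Complex.normSq p + Complex.normSq q) + Complex.normSq r) /
        (herm c z z).re ^ 2 := by
    rw [gramForm, h1, herm_self c z, ← Complex.ofReal_pow, ← Complex.ofReal_div,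
      ← Complex.ofReal_mul, Complex.ofReal_re, mul_div_assoc]
    simp
  have h3 : ¬ (p = 0 ∧ q = 0 ∧ r = 0) := by
    rintro ⟨hp0, hq0, hr0⟩
    refine hu (funext fun j => ?_)
    rw [hp] at hp0
    rw [hq] at hq0
    rw [hr] at hr0
    rw [Pi.zero_apply]
    fin_cases i <;> fin_cases j <;> simp_all
  rw [h2]
  have hr' : z 0 * r = z 1 * q - z 2 * p := by rw [hp, hq, hr]; ring
  have hpn := Complex.normSq_nonneg p
  have hqn := Complex.normSq_nonneg q
  have hrn := Complex.normSq_nonneg r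
  have hz2 : (herm c z z).re = Complex.normSq (z 0) +
      Real.sign c * (Complex.normSq (z 1) + Complex.normSq (z 2)) := by
    rw [herm, Complex.mul_conj, Complex.mul_conj, Complex.mul_conj, ← Complex.ofReal_add,
      ← Complex.ofReal_mul, ← Complex.ofReal_add, Complex.ofReal_re]
  refine div_pos ?_ (pow_pos hz 2)
  rcases lt_or_gt_of_ne hc with h | h
  · rw [Real.sign_of_neg h] at hz2 ⊢
    refine mul_pos_of_neg_of_neg (div_neg_of_pos_of_neg (by norm_num) h) ?_
    have hz1 := Complex.normSq_nonneg (z 1)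
    have hz2' := Complex.normSq_nonneg (z 2)
    have hz0 : 0 < Complex.normSq (z 0) := by linarith
    have h4 : 0 < Complex.normSq p + Complex.normSq q := by
      by_contra hcon
      have hp0 : p = 0 := Complex.normSq_eq_zero.1 (by linarith)
      have hq0 : q = 0 := Complex.normSq_eq_zero.1 (by linarith)
      refine h3 ⟨hp0, hq0, ?_⟩
      rw [hp0, hq0, mul_zero, mul_zero, sub_zero] at hr'
      exact (mul_eq_zero.1 hr').resolve_left (Complex.normSq_pos.1 hz0)
    -- The Cauchy-Schwarz inequality for z₁ q - z₂ p, with its defect made explicit.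
    have h5 : Complex.normSq (z 0) * Complex.normSq r +
        Complex.normSq (conj (z 1) * p + conj (z 2) * q) =
        (Complex.normSq (z 1) + Complex.normSq (z 2)) * (Complex.normSq p + Complex.normSq q) := by
      rw [← Complex.normSq_mul, hr']
      simp only [Complex.normSq_apply, Complex.sub_re, Complex.sub_im, Complex.add_re,
        Complex.add_im, Complex.mul_re, Complex.mul_im, Complex.conj_re, Complex.conj_im]
      ring
    have h6 := Complex.normSq_nonneg (conj (z 1) * p + conj (z 2) * q)
    have h7 := mul_pos hz h4
    rw [hz2] at h7
    have h8 : Complex.normSq (z 0) *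
      (Complex.normSq p + Complex.normSq q - Complex.normSq r) > 0 := by linarith
    have h9 := pos_of_mul_pos_right h8 hz0.le
    linarith
  · rw [Real.sign_of_pos h, one_mul]
    refine mul_pos (div_pos (by norm_num) h) ?_
    by_contra hcon
    exact h3 ⟨Complex.normSq_eq_zero.1 (by linarith), Complex.normSq_eq_zero.1 (by linarith),
      Complex.normSq_eq_zero.1 (by linarith)⟩

/-- The Hermitian matrix of three vectors that are projected to the orthogonal complement of `z`
in `ℂ³` is degenerate. -/
lemma gramForm_det_eq_zero {c : ℝ} {z : Fin 3 → ℂ} (hz : 0 < (herm c z z).re)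
    (u : Fin 3 → Fin 3 → ℂ) :
    (Matrix.of fun a b => gramForm c z (u a) (u b)).det = 0 := by
  set t : ℂ := (((√(herm c z z).re)⁻¹ : ℝ) : ℂ) with ht
  have hne : herm c z z ≠ 0 := fun h => by simp [h] at hz
  have ht2 : t ^ 2 * herm c z z = 1 := by
    rw [herm_self, ht, ← Complex.ofReal_pow, ← Complex.ofReal_mul, inv_pow, Real.sq_sqrt hz.le,
      inv_mul_cancel₀ hz.ne', Complex.ofReal_one]
  have hts : conj t = t := Complex.conj_ofReal _
  have key : ∀ a b, gramForm c z (u a) (u b) = ((4 / c : ℝ) : ℂ) *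
      sesq ((Real.sign c : ℝ) : ℂ) (fun j => t * (u a j - herm c (u a) z / herm c z z * z j))
        (fun j => t * (u b j - herm c (u b) z / herm c z z * z j)) := fun a b => by
    have h1 : sesq ((Real.sign c : ℝ) : ℂ)
        (fun j => t * (u a j - herm c (u a) z / herm c z z * z j))
        (fun j => t * (u b j - herm c (u b) z / herm c z z * z j)) =
        t ^ 2 * (herm c (u a) (u b) - herm c (u a) z * herm c z (u b) / herm c z z) := by
      have h2 : conj (herm c (u b) z / herm c z z) = herm c z (u b) / herm c z z := by
        rw [map_div₀, herm_conj, herm_conj]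
      set m := herm c (u a) z / herm c z z with hm
      set n := herm c z (u b) / herm c z z with hn
      have hm' : herm c (u a) z = m * herm c z z := by rw [hm]; field_simp
      have hn' : herm c z (u b) = n * herm c z z := by rw [hn]; field_simp
      have h3 : sesq ((Real.sign c : ℝ) : ℂ) (fun j => t * (u a j - m * z j))
          (fun j => t * (u b j - herm c (u b) z / herm c z z * z j)) =
          t ^ 2 * (herm c (u a) (u b) - m * herm c z (u b) - n * herm c (u a) z +
            m * n * herm c z z) := by
        generalize herm c (u b) z / herm c z z = k at h2
        rw [← h2]
        simp only [sesq, ← starRingEnd_apply, map_mul, map_sub, hts, herm]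
        ring
      rw [h3, hm', hn']
      field_simp
      ring
    rw [h1, gramForm, eq_div_of_mul_eq hne ht2]
    field_simp
  simp_rw [key]
  refine det_gram_eq_zero (Z := t • z) ?_ _ fun a => ?_
  · rw [← ht2, herm]
    simp only [sesq, Pi.smul_apply, smul_eq_mul, ← starRingEnd_apply, map_mul, hts]
    ring
  · have h1 : sesq ((Real.sign c : ℝ) : ℂ)
        (fun j => t * (u a j - herm c (u a) z / herm c z z * z j)) (t • z) =
        t ^ 2 * (herm c (u a) z - herm c (u a) z / herm c z z * herm c z z) := by
      generalize herm c (u a) z / herm c z z = m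
      simp only [sesq, Pi.smul_apply, smul_eq_mul, ← starRingEnd_apply, map_mul, hts, herm]
      ring
    rw [h1, div_mul_cancel₀ _ hne, sub_self, mul_zero]

/-- The vector `kernelVec` has length one and its real span is orthogonal to the `i`-multiples of
the given vectors. -/
lemma gramForm_kernelVec {c : ℝ} {z : Fin 3 → ℂ} (hz : 0 < (herm c z z).re)
    (u : Fin 3 → Fin 3 → ℂ) (g : Matrix (Fin 3) (Fin 3) ℝ)
    (hg : ∀ a b, g a b = (gramForm c z (u a) (u b)).re) (hdet : 0 < g.det) {x : E3}
    (hx : x = kernelVec (fun a b => gramForm c z (u a) (u b)) g.det) :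
    (gramForm c z (∑ a, x a • u a) (∑ a, x a • u a)).re = 1 ∧
      ∀ b, (gramForm c z (Complex.I • ∑ a, x a • u a) (u b)).re = 0 := by
  have hH : ∀ a b, (g a b : ℂ) = 1 / 2 * (gramForm c z (u a) (u b) + gramForm c z (u b) (u a)) :=
    fun a b => by
      rw [hg, ← gramForm_conj c z (u a) (u b), Complex.add_conj]; push_cast; ring
  have him : ∀ a b, ((gramForm c z (u a) (u b)).im : ℂ) = -Complex.I * (1 / 2) *
      (gramForm c z (u a) (u b) - gramForm c z (u b) (u a)) := fun a b => by
    rw [← gramForm_conj c z (u a) (u b), Complex.sub_conj]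
    push_cast
    linear_combination ((gramForm c z (u a) (u b)).im : ℂ) * Complex.I_mul_I
  have hgd : (Complex.ofRealHom.mapMatrix g).det = (g.det : ℂ) :=
    (RingHom.map_det Complex.ofRealHom g).symm
  obtain ⟨-, h2, h3⟩ := kernel_of_det_eq_zero (i := Complex.I) (h := 1 / 2)
    (r := (((√g.det)⁻¹ : ℝ) : ℂ)) Complex.I_sq (by norm_num)
    (Matrix.of fun a b => gramForm c z (u a) (u b)) (Complex.ofRealHom.mapMatrix g)
    (gramForm_det_eq_zero hz u) hH
    (by rw [hgd, ← Complex.ofReal_pow, ← Complex.ofReal_mul, inv_pow, Real.sq_sqrt hdet.le,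
      inv_mul_cancel₀ hdet.ne', Complex.ofReal_one])
    (fun a b => ((gramForm c z (u a) (u b)).im : ℂ)) him (fun a => (x a : ℂ))
    (by simp [hx, kernelVec]) (by simp [hx, kernelVec]) (by simp [hx, kernelVec])
  -- The kernel property makes these Hermitian products real, so multiplying by i leaves no real
  -- part; this is normality.
  have h2' : ∀ b, ∑ a, x a * gramForm c z (u a) (u b) = ((∑ a, g b a * x a : ℝ) : ℂ) := fun b => by
    have := h2 b
    simp only [Matrix.of_apply, RingHom.mapMatrix_apply, Matrix.map_apply,
      Complex.ofRealHom_eq_coe] at this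
    push_cast
    rw [← this]
    exact Finset.sum_congr rfl fun _ _ => mul_comm _ _
  constructor
  · have h4 : gramForm c z (∑ a, x a • u a) (∑ a, x a • u a) = 1 := by
      have h5 := gramForm_smul_sum_left c z (∑ a, x a • u a) 1 u x
      rw [one_smul, one_mul] at h5
      rw [h5, ← h3]
      simp_rw [gramForm_sum_right]
      simp only [Fin.sum_univ_three, RingHom.mapMatrix_apply,
        Matrix.map_apply, Complex.ofRealHom_eq_coe] at h2' ⊢
      push_cast at h2'
      linear_combination (x 0 : ℂ) * h2' 0 + (x 1 : ℂ) * h2' 1 + (x 2 : ℂ) * h2' 2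
    rw [h4, Complex.one_re]
  · intro b
    rw [gramForm_smul_sum_left, h2', mul_comm, Complex.re_ofReal_mul, Complex.I_re, mul_zero]

end Gram

/-! ### Lifts of tangent vectors and positivity of the ambient metric -/

section Ambient

lemma insertAt_affineCoord {i : Fin 3} {q : CP2} (h : q.rep i ≠ 0) :
    insertAt i 1 (affineCoord i q) = (q.rep i)⁻¹ • q.rep := by
  funext j
  rcases Fin.eq_self_or_eq_succAbove i j with rfl | ⟨k, rfl⟩
  · simp [h]
  · simp [affineCoord, div_eq_inv_mul]

lemma rep_chartIndex_ne_zero (q : CP2) : q.rep (chartIndex q) ≠ 0 :=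
  q.exists_rep_ne_zero.choose_spec

lemma herm_smul_smul (c : ℝ) (a : ℂ) (z w : Fin 3 → ℂ) :
    herm c (a • z) (a • w) = (Complex.normSq a : ℝ) * herm c z w := by
  rw [← Complex.mul_conj]
  simp only [herm, Pi.smul_apply, smul_eq_mul, map_mul]
  ring

lemma herm_insertAt_pos {c : ℝ} {q : CP2} (hq : q ∈ spaceForm c) {i : Fin 3} (h : q.rep i ≠ 0) :
    0 < (herm c (insertAt i 1 (affineCoord i q)) (insertAt i 1 (affineCoord i q))).re := by
  rw [insertAt_affineCoord h, herm_smul_smul, Complex.re_ofReal_mul]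
  exact mul_pos (Complex.normSq_pos.2 (inv_ne_zero h)) hq

lemma ambientMetric_eq (c : ℝ) (q : CP2) (X Y : AmbientTangent q) :
    ambientMetric c q X Y = (gramForm c (homCoord q) (tangentLift q X) (tangentLift q Y)).re := by
  rw [gramForm, Complex.re_ofReal_mul]
  rfl

lemma tangentLift_chartIndex (q : CP2) (X : AmbientTangent q) :
    tangentLift q X (chartIndex q) = 0 :=
  insertAt_same _ _ _

lemma tangentLift_succAbove (q : CP2) (w : Fin 2 → ℂ) (k : Fin 2) :
    tangentLift q w ((chartIndex q).succAbove k) = w k :=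
  insertAt_succAbove _ _ _ _

lemma tangentLift_sum_smul (q : CP2) (x : Fin 3 → ℝ) (X : Fin 3 → AmbientTangent q) :
    tangentLift q (∑ a, x a • X a) = ∑ a, x a • tangentLift q (X a) := by
  funext j
  rw [Finset.sum_apply]
  rcases Fin.eq_self_or_eq_succAbove (chartIndex q) j with rfl | ⟨k, rfl⟩
  · simp only [Pi.smul_apply, tangentLift_chartIndex, smul_zero, Finset.sum_const_zero]
  · refine (tangentLift_succAbove q _ k).trans ((Finset.sum_apply k Finset.univ
      (fun a => (x a • X a : Fin 2 → ℂ))).trans (Finset.sum_congr rfl fun a _ => ?_))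
    exact congrArg (x a • ·) (tangentLift_succAbove q (X a) k).symm

lemma tangentLift_ambientJ (q : CP2) (X : AmbientTangent q) :
    tangentLift q (ambientJ q X) = Complex.I • tangentLift q X := by
  funext j
  rcases Fin.eq_self_or_eq_succAbove (chartIndex q) j with rfl | ⟨k, rfl⟩
  · simp only [Pi.smul_apply, tangentLift_chartIndex, smul_zero]
  · exact (tangentLift_succAbove q _ k).trans
      (congrArg (Complex.I * ·) (tangentLift_succAbove q X k).symm)

lemma neg_ambientJ_ambientJ (q : CP2) (X : AmbientTangent q) :
    -ambientJ q (ambientJ q X) = X := by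
  funext k
  change -(Complex.I * (Complex.I * (show Fin 2 → ℂ from X) k)) = _
  rw [← mul_assoc, Complex.I_mul_I, neg_one_mul, neg_neg]

lemma tangentLift_eq_zero {q : CP2} {X : AmbientTangent q} (h : tangentLift q X = 0) : X = 0 := by
  funext k
  exact (tangentLift_succAbove q X k).symm.trans (congrFun h _)

/-- The metric of the space form is positive definite. -/
lemma ambientMetric_self_pos {c : ℝ} (hc : c ≠ 0) {q : CP2} (hq : q ∈ spaceForm c)
    {X : AmbientTangent q} (hX : X ≠ 0) : 0 < ambientMetric c q X X := by
  rw [ambientMetric_eq]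
  exact gramForm_self_re_pos hc (herm_insertAt_pos hq (rep_chartIndex_ne_zero q))
    (i := chartIndex q) (by simp [homCoord]) (tangentLift_chartIndex q X)
    fun h => hX (tangentLift_eq_zero h)

lemma ambientMetric_comm (c : ℝ) (q : CP2) (X Y : AmbientTangent q) :
    ambientMetric c q X Y = ambientMetric c q Y X := by
  rw [ambientMetric_eq, ambientMetric_eq, ← gramForm_conj, Complex.conj_re]

lemma ambientMetric_sum_smul (c : ℝ) (q : CP2) (x : Fin 3 → ℝ) (X : Fin 3 → AmbientTangent q)
    (N : AmbientTangent q) :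
    ambientMetric c q N (∑ a, x a • X a) = ∑ a, x a * ambientMetric c q N (X a) := by
  simp only [ambientMetric_eq, tangentLift_sum_smul, gramForm_sum_right, Complex.re_sum,
    Complex.re_ofReal_mul]

/-- The Gram matrix of linearly independent vectors has positive determinant. -/
lemma det_ambientMetric_pos {c : ℝ} (hc : c ≠ 0) {q : CP2} (hq : q ∈ spaceForm c)
    {X : Fin 3 → AmbientTangent q} (hX : LinearIndependent ℝ X) :
    0 < (Matrix.of fun a b => ambientMetric c q (X a) (X b)).det := by
  refine Matrix.PosDef.det_pos (Matrix.PosDef.of_dotProduct_mulVec_pos ?_ fun x hx => ?_)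
  · ext a b
    simpa using ambientMetric_comm c q (X b) (X a)
  · have h1 : ∑ a, x a • X a ≠ 0 := fun h =>
      hx (funext fun a => Fintype.linearIndependent_iff.1 hX x h a)
    refine (ambientMetric_self_pos hc hq h1).trans_eq ?_
    rw [ambientMetric_sum_smul]
    simp only [Matrix.mulVec, dotProduct, Matrix.of_apply, star_trivial]
    refine Finset.sum_congr rfl fun a _ => ?_
    rw [ambientMetric_comm, ambientMetric_sum_smul]
    congr 1
    exact Finset.sum_congr rfl fun b _ => by rw [ambientMetric_comm, mul_comm]

end Ambient

/-! ### The structure vector in a chart of the hypersurface -/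

section Chart

variable {M : Type*} [TopologicalSpace M] [ChartedSpace E3 M]

lemma differential_sum_smul (f : M → CP2) (p : M) (x : Fin 3 → ℝ)
    (X : Fin 3 → TangentSpace 𝓘(ℝ, E3) p) :
    differential f p (∑ a, x a • X a) = ∑ a, x a • differential f p (X a) := by
  simp only [differential]
  rw [map_sum]
  exact Finset.sum_congr rfl fun a _ => map_smul _ _ _

lemma components_sum_smul (e : OpenPartialHomeomorph M E3) (p : M) (x : Fin 3 → ℝ)
    (X : Fin 3 → TangentSpace 𝓘(ℝ, E3) p) :
    components e p (∑ a, x a • X a) = ∑ a, x a • components e p (X a) := by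
  simp only [components]
  rw [map_sum]
  exact Finset.sum_congr rfl fun a _ => map_smul _ _ _

variable [IsManifold 𝓘(ℝ, E3) ∞ M]

lemma components_coordVector {e : OpenPartialHomeomorph M E3} (he : e ∈ atlas E3 M) {y : E3}
    (hy : y ∈ e.target) (a : Fin 3) :
    components e (e.symm y) (coordVector e a y) = EuclideanSpace.single a 1 :=
  congrArg (fun L => L (EuclideanSpace.single a (1 : ℝ) : E3))
    ((mdifferentiable_of_mem_atlas (I := 𝓘(ℝ, E3)) he).comp_symm_deriv hy)

lemma sum_smul_single (x : E3) : ∑ a, x a • (EuclideanSpace.single a (1 : ℝ) : E3) = x := by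
  ext j
  simp [Pi.single_apply]

lemma components_sum_coordVector {e : OpenPartialHomeomorph M E3} (he : e ∈ atlas E3 M) {y : E3}
    (hy : y ∈ e.target) (x : E3) :
    components e (e.symm y) (∑ a, x a • coordVector e a y) = x := by
  rw [components_sum_smul]
  simp only [components_coordVector he hy]
  exact sum_smul_single x

lemma components_injective {e : OpenPartialHomeomorph M E3} (he : e ∈ atlas E3 M) {p : M}
    (hp : p ∈ e.source) : Function.Injective (components e p) :=
  (mdifferentiable_of_mem_atlas (I := 𝓘(ℝ, E3)) he).mfderiv_injective hp

lemma sum_components_coordVector {e : OpenPartialHomeomorph M E3} (he : e ∈ atlas E3 M) {y : E3}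
    (hy : y ∈ e.target) (X : TangentSpace 𝓘(ℝ, E3) (e.symm y)) :
    ∑ a, components e (e.symm y) X a • coordVector e a y = X :=
  components_injective he (e.map_target hy) (components_sum_coordVector he hy _)

lemma linearIndependent_differential_coordVector {f : M → CP2} {e : OpenPartialHomeomorph M E3}
    (he : e ∈ atlas E3 M) {y : E3} (hy : y ∈ e.target)
    (hf : Function.Injective (mfderiv 𝓘(ℝ, E3) 𝓘(ℝ, Fin 2 → ℂ) f (e.symm y))) :
    LinearIndependent ℝ fun a => differential f (e.symm y) (coordVector e a y) := by
  rw [Fintype.linearIndependent_iff]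
  intro x hx a
  rw [← differential_sum_smul] at hx
  have h1 : ∑ a, x a • coordVector e a y = 0 := hf (hx.trans (map_zero _).symm)
  have h2 := components_sum_coordVector he hy (WithLp.toLp 2 x)
  change components e (e.symm y) (∑ a, x a • coordVector e a y) = _ at h2
  rw [h1] at h2
  have h3 : (0 : E3) = WithLp.toLp 2 x :=
    (map_zero (mfderiv 𝓘(ℝ, E3) 𝓘(ℝ, E3) e (e.symm y))).symm.trans h2
  exact (congrArg (fun v : E3 => v a) h3).symm

lemma det_metricInChart_pos {c : ℝ} (hc : c ≠ 0) {f : M → CP2} (hf : IsRealHypersurface c f)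
    {e : OpenPartialHomeomorph M E3} (he : e ∈ atlas E3 M) {y : E3} (hy : y ∈ e.target) :
    0 < (metricInChart c f e y).det :=
  det_ambientMetric_pos hc (hf.mem_spaceForm _)
    (linearIndependent_differential_coordVector he hy (hf.immersion _))

/-- In a chart, the structure vector is given by `kernelVec`. -/
lemma isStructureVector_kernelVec {c : ℝ} (hc : c ≠ 0) {f : M → CP2}
    (hf : IsRealHypersurface c f) {e : OpenPartialHomeomorph M E3} (he : e ∈ atlas E3 M) {y : E3}
    (hy : y ∈ e.target) {x : E3}
    (hx : x = kernelVec (fun a b => gramForm c (homCoord (f (e.symm y)))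
      (tangentLift _ (differential f (e.symm y) (coordVector e a y)))
      (tangentLift _ (differential f (e.symm y) (coordVector e b y))))
        (metricInChart c f e y).det) :
    IsStructureVector c f (e.symm y) (∑ a, x a • coordVector e a y) := by
  obtain ⟨h1, h2⟩ := gramForm_kernelVec (z := homCoord (f (e.symm y)))
    (herm_insertAt_pos (hf.mem_spaceForm _) (rep_chartIndex_ne_zero _))
    (fun a => tangentLift _ (differential f (e.symm y) (coordVector e a y)))
    (metricInChart c f e y) (fun a b => ambientMetric_eq _ _ _ _)
    (det_metricInChart_pos hc hf he hy) hx
  refine ⟨ambientJ _ (differential f (e.symm y) (∑ a, x a • coordVector e a y)), ⟨?_, ?_⟩,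
    (neg_ambientJ_ambientJ _ _).symm⟩
  · rw [ambientMetric_eq, tangentLift_ambientJ, gramForm_I_smul, differential_sum_smul,
      tangentLift_sum_smul, h1]
  · intro X
    rw [← sum_components_coordVector he hy X, differential_sum_smul f _ (components e _ X),
      ambientMetric_sum_smul]
    refine Finset.sum_eq_zero fun b _ => ?_
    rw [ambientMetric_eq, tangentLift_ambientJ, differential_sum_smul, tangentLift_sum_smul, h2,
      mul_zero]

lemma riemann_eq_zero_of_structureJacobiVanishes {c : ℝ} (hc : c ≠ 0) {f : M → CP2}
    (hf : IsRealHypersurface c f) (hJ : StructureJacobiVanishes c f)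
    {e : OpenPartialHomeomorph M E3} (he : e ∈ atlas E3 M) {y : E3}
    (hy : y ∈ e.target) (a : Fin 3) {x : E3}
    (hx : x = kernelVec (fun a b => gramForm c (homCoord (f (e.symm y)))
      (tangentLift _ (differential f (e.symm y) (coordVector e a y)))
      (tangentLift _ (differential f (e.symm y) (coordVector e b y))))
        (metricInChart c f e y).det) :
    riemann (metricInChart c f e) y (EuclideanSpace.single a 1) x x = 0 := by
  have h := hJ (e.symm y) e he (e.map_target hy) _ (isStructureVector_kernelVec hc hf he hy hx)
    (coordVector e a y)
  rwa [curvatureInChart, components_coordVector he hy, components_sum_coordVector he hy,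
    e.right_inv hy] at h

end Chart

/-! ### Smooth local lifts and the differential -/

section Lift

variable {M : Type*} [TopologicalSpace M]

/-- The points of a chart whose image lies in the domain of the affine chart of index `i`. -/
def liftDomain (f : M → CP2) (e : OpenPartialHomeomorph M E3) (i : Fin 3) : Set E3 :=
  e.target ∩ e.symm ⁻¹' (f ⁻¹' {q | q.rep i ≠ 0})

lemma isOpen_liftDomain {f : M → CP2} (hf : Continuous f) (e : OpenPartialHomeomorph M E3)
    (i : Fin 3) : IsOpen (liftDomain f e i) :=
  e.isOpen_inter_preimage_symm ((isOpen_affine i).preimage hf)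

/-- A lift of `f` to `ℂ³`, in a chart. -/
def localLift (f : M → CP2) (e : OpenPartialHomeomorph M E3) (i j : Fin 3) (y : E3) : ℂ :=
  insertAt i 1 (affineCoord i (f (e.symm y))) j

lemma localLift_eq {f : M → CP2} {e : OpenPartialHomeomorph M E3} {i : Fin 3} {y : E3}
    (hy : y ∈ liftDomain f e i) :
    (fun j => localLift f e i j y) = ((f (e.symm y)).rep i)⁻¹ • (f (e.symm y)).rep :=
  insertAt_affineCoord hy.2

lemma affineCoord_eq_localLift {f : M → CP2} {e : OpenPartialHomeomorph M E3} {i : Fin 3} {y : E3}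
    (hy : y ∈ liftDomain f e i) (j : Fin 3) (k : Fin 2) :
    affineCoord j (f (e.symm y)) k =
      localLift f e i (j.succAbove k) y / localLift f e i j y := by
  have h : (f (e.symm y)).rep i ≠ 0 := hy.2
  have h1 : ∀ j, localLift f e i j y = ((f (e.symm y)).rep i)⁻¹ * (f (e.symm y)).rep j :=
    fun j => congrFun (localLift_eq hy) j
  rw [h1, h1, mul_div_mul_left _ _ (inv_ne_zero h), affineCoord]

variable [ChartedSpace E3 M] [IsManifold 𝓘(ℝ, E3) ∞ M]

lemma contDiffOn_localLift {f : M → CP2} (hf : ContMDiff 𝓘(ℝ, E3) 𝓘(ℝ, Fin 2 → ℂ) ∞ f)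
    {e : OpenPartialHomeomorph M E3} (he : e ∈ atlas E3 M) (i j : Fin 3) :
    ContDiffOn ℝ ∞ (localLift f e i j) (liftDomain f e i) := by
  have h1 : ContMDiffOn 𝓘(ℝ, E3) 𝓘(ℝ, E3) ∞ e.symm e.target :=
    contMDiffOn_symm_of_mem_maximalAtlas (IsManifold.subset_maximalAtlas he)
  have h2 : ContMDiffOn 𝓘(ℝ, Fin 2 → ℂ) 𝓘(ℝ, Fin 2 → ℂ) ∞ (affineChart i) (affineChart i).source :=
    contMDiffOn_of_mem_maximalAtlas (IsManifold.subset_maximalAtlas ⟨i, rfl⟩)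
  have h3 : ContMDiffOn 𝓘(ℝ, E3) 𝓘(ℝ, Fin 2 → ℂ) ∞ (affineChart i ∘ f ∘ e.symm)
      (liftDomain f e i) :=
    h2.comp ((hf.comp_contMDiffOn h1).mono Set.inter_subset_left) fun y hy => hy.2
  rw [contMDiffOn_iff_contDiffOn, contDiffOn_pi] at h3
  rcases Fin.eq_self_or_eq_succAbove i j with rfl | ⟨k, rfl⟩
  · exact contDiffOn_const.congr fun y _ => insertAt_same _ _ _
  · exact (h3 k).congr fun y _ => insertAt_succAbove _ _ _ _

/-- Tangent vectors are read in the preferred chart of the base point, so the chart index stays that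
of `y` while `y'` varies. -/
lemma differential_coordVector {f : M → CP2} (hf : ContMDiff 𝓘(ℝ, E3) 𝓘(ℝ, Fin 2 → ℂ) ∞ f)
    {e : OpenPartialHomeomorph M E3} (he : e ∈ atlas E3 M) {y : E3} (hy : y ∈ e.target)
    (a : Fin 3) :
    differential f (e.symm y) (coordVector e a y) =
      fderiv ℝ (fun y' => affineCoord (chartIndex (f (e.symm y))) (f (e.symm y'))) y
        (EuclideanSpace.single a 1) := by
  have h1 : MDifferentiableAt 𝓘(ℝ, E3) 𝓘(ℝ, Fin 2 → ℂ) f (e.symm y) :=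
    hf.mdifferentiableAt (by simp)
  have h2 : MDifferentiableAt 𝓘(ℝ, E3) 𝓘(ℝ, E3) e.symm y :=
    (mdifferentiable_of_mem_atlas (I := 𝓘(ℝ, E3)) he).mdifferentiableAt_symm hy
  have h3 := mfderiv_comp y h1 h2
  have h4 := (h1.comp y h2).mfderiv
  rw [h3] at h4
  have h5 := congrArg (fun L => L (EuclideanSpace.single a (1 : ℝ) : E3)) h4
  refine h5.trans ?_
  simp only [mfld_simps, writtenInExtChartAt, fderivWithin_univ]
  rfl

/-- The lift of `∂_a` at the point `[z]` is `∂_a (λ z)`, for the normalization `λ z` of `z`. -/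
lemma exists_tangentLift_eq {f : M → CP2} (hf : ContMDiff 𝓘(ℝ, E3) 𝓘(ℝ, Fin 2 → ℂ) ∞ f)
    {e : OpenPartialHomeomorph M E3} (he : e ∈ atlas E3 M) {i : Fin 3} {y : E3}
    (hy : y ∈ liftDomain f e i) :
    ∃ l : ℂ, l ≠ 0 ∧ homCoord (f (e.symm y)) = l • (fun j => localLift f e i j y) ∧
      ∀ a, ∃ b : ℂ, tangentLift _ (differential f (e.symm y) (coordVector e a y)) =
        l • liftDeriv (localLift f e i) a y + b • (fun j => localLift f e i j y) := by
  have hrep : (f (e.symm y)).rep i ≠ 0 := hy.2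
  set m := chartIndex (f (e.symm y)) with hm
  have hU := isOpen_liftDomain hf.continuous e i
  have hzm : localLift f e i m y ≠ 0 := by
    rw [congrFun (localLift_eq hy) m]
    exact mul_ne_zero (inv_ne_zero hrep) (rep_chartIndex_ne_zero _)
  have hd : ∀ j, HasFDerivAt (localLift f e i j) (fderiv ℝ (localLift f e i j) y) y := fun j =>
    (((contDiffOn_localLift hf he i j).contDiffAt (hU.mem_nhds hy)).differentiableAt
      (by simp)).hasFDerivAt
  -- Normalizing the coordinate `m` to 1 divides by `z_m`; the coefficient `b` is the quotient-rule
  -- term from the derivative of 1/z_m.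
  refine ⟨(localLift f e i m y)⁻¹, inv_ne_zero hzm, ?_, fun a =>
    ⟨-(liftDeriv (localLift f e i) a y m) / localLift f e i m y ^ 2, ?_⟩⟩
  · funext j
    rcases Fin.eq_self_or_eq_succAbove m j with rfl | ⟨k, rfl⟩
    · rw [homCoord, insertAt_same, Pi.smul_apply, smul_eq_mul, inv_mul_cancel₀ hzm]
    · rw [homCoord, insertAt_succAbove, affineCoord_eq_localLift hy, Pi.smul_apply, smul_eq_mul,
        div_eq_inv_mul]
  · have h1 : HasFDerivAt (fun y' => affineCoord m (f (e.symm y')))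
        (ContinuousLinearMap.pi fun k =>
          (localLift f e i m y ^ 2)⁻¹ • (localLift f e i m y •
            fderiv ℝ (localLift f e i (m.succAbove k)) y -
            localLift f e i (m.succAbove k) y • fderiv ℝ (localLift f e i m) y)) y := by
      rw [hasFDerivAt_pi]
      intro k
      refine HasFDerivAt.congr_of_eventuallyEq (((hd (m.succAbove k)).mul
        ((hasFDerivAt_inv' (𝕜 := ℝ) hzm).comp y (hd m))).congr_fderiv ?_) ?_
      · ext v
        simp only [add_apply, sub_apply, smul_apply, smul_eq_mul, ContinuousLinearMap.comp_apply,
          neg_apply, ContinuousLinearMap.mulLeftRight_apply, Function.comp_apply]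
        field_simp
        ring
      · filter_upwards [hU.mem_nhds hy] with y' hy'
        exact (affineCoord_eq_localLift hy' m k).trans (div_eq_mul_inv _ _)
    have h2 := differential_coordVector hf he hy.1 a
    rw [← hm, h1.fderiv] at h2
    funext j
    rcases Fin.eq_self_or_eq_succAbove m j with rfl | ⟨k, rfl⟩
    · refine (tangentLift_chartIndex _ _).trans ?_
      simp only [Pi.add_apply, Pi.smul_apply, smul_eq_mul]
      field_simp
      ring
    · rw [h2]
      refine (tangentLift_succAbove _ _ k).trans ?_
      simp only [Pi.add_apply, Pi.smul_apply, smul_eq_mul, ContinuousLinearMap.pi_apply,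
        smul_apply, sub_apply, liftDeriv]
      field_simp
      ring

end Lift

end SpaceForm

end

/-! ### Reduction of the theorem to a local lift -/

theorem proposition3p2 (c : ℝ) (hc : c ≠ 0) {M : Type*} [TopologicalSpace M]
    [ChartedSpace SpaceForm.E3 M] [IsManifold 𝓘(ℝ, SpaceForm.E3) ∞ M] [Nonempty M]
    (f : M → SpaceForm.CP2) (hf : SpaceForm.IsRealHypersurface c f) :
    ¬ SpaceForm.StructureJacobiVanishes c f := by
  intro hJ
  let p : M := Classical.arbitrary M
  let e := chartAt SpaceForm.E3 p
  have he : e ∈ atlas SpaceForm.E3 M := chart_mem_atlas _ p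
  have hp : p ∈ e.source := mem_chart_source _ p
  -- The index is frozen at `p`: the chosen index at nearby points may jump, which would spoil the
  -- smoothness of the lift.
  let i := SpaceForm.chartIndex (f p)
  have hgram : ∀ y ∈ SpaceForm.liftDomain f e i, ∀ a b,
      SpaceForm.gramForm c (SpaceForm.homCoord (f (e.symm y)))
        (SpaceForm.tangentLift _ (SpaceForm.differential f (e.symm y)
          (SpaceForm.coordVector e a y)))
        (SpaceForm.tangentLift _ (SpaceForm.differential f (e.symm y)
          (SpaceForm.coordVector e b y))) =
      SpaceForm.gramForm c (fun j => SpaceForm.localLift f e i j y)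
        (SpaceForm.liftDeriv (SpaceForm.localLift f e i) a y)
        (SpaceForm.liftDeriv (SpaceForm.localLift f e i) b y) := fun y hy a b => by
    obtain ⟨l, hl, h1, h2⟩ := SpaceForm.exists_tangentLift_eq hf.smooth he hy
    obtain ⟨d, hd⟩ := h2 a
    obtain ⟨d', hd'⟩ := h2 b
    rw [h1, hd, hd', SpaceForm.gramForm_smul_add c _ _ _ hl]
  refine SpaceForm.local_hypersurface_inconsistent hc
    (SpaceForm.isOpen_liftDomain hf.smooth.continuous e i) ⟨e p, e.map_source hp, ?_⟩
    (SpaceForm.localLift f e i) (SpaceForm.contDiffOn_localLift hf.smooth he i)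
    (fun y hy => SpaceForm.herm_insertAt_pos (hf.mem_spaceForm _) hy.2)
    (SpaceForm.metricInChart c f e)
    (fun y hy a b => (SpaceForm.ambientMetric_eq _ _ _ _).trans
      (congrArg Complex.re (hgram y hy a b)))
    (fun y hy => SpaceForm.det_metricInChart_pos hc hf he hy.1) fun y hy a x hx => ?_
  · rw [Set.mem_preimage, e.left_inv hp]
    exact SpaceForm.rep_chartIndex_ne_zero _
  · refine SpaceForm.riemann_eq_zero_of_structureJacobiVanishes hc hf hJ he hy.1 a ?_
    simp only [hgram y hy]
    exact hx
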